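/- Let $U(t)$, $t\in\mathbb R$, denote the Airy group: for $f\in C_0^\infty(\mathbb R)$ (complex-valued), $U(t)f=\big(e^{it\xi^3}\hat f\,\big)^{\vee}$, where $\hat f(\xi)=\int_{\mathbb R}e^{-ix\xi}f(x)\,dx$ and ${}^\vee$ is the inverse Fourier transform; that is, $u(x,t)=U(t)f(x)$ solves $\partial_tu+\partial_x^3u=0$, $u(x,0)=f(x)$. For $\sigma\in\mathbb R$ let $\|f\|_{H^\sigma}=\|\langle D_x\rangle^{\sigma}f\|_{2}$, where $\langle D_x\rangle^\sigma$ is the Fourier multiplier with symbol $(1+\xi^2)^{\sigma/2}$. **Lemma 4.6.** Let $s\ge 0$ be real. There is a constant $C$ depending only on $s$ such that for all $u_0\in C_0^\infty(\mathbb R)$ and all $t\in\mathbb R$, $$\big\||x|^{s}U(t)u_0\big\|_{2}\le C\Big((1+|t|+|t|^{s})\,\|u_0\|_{H^{2s}}+\big\||x|^{s}u_0\big\|_{2}\Big).$$ In particular the left-hand side is finite. -/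

import Mathlib

open MeasureTheory FourierTransform
open scoped ENNReal NNReal ContDiff

/-- The Airy group `U(t)`: the Fourier multiplier with symbol `exp (i t k ^ 3)` at angular
frequency `k`, that is, the solution operator of `∂ₜ u + ∂ₓ³ u = 0`, `u(0) = f`.  Mathlib's Fourier
transform is normalised by `𝓕 f ξ = ∫ exp (-2 π i x ξ) f x dx`, so that `k = 2 π ξ`. -/
noncomputable def airyGroup (t : ℝ) (f : ℝ → ℂ) : ℝ → ℂ :=
  𝓕⁻ fun ξ : ℝ => Complex.exp (Complex.I * t * (2 * Real.pi * ξ) ^ 3) * 𝓕 f ξ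

/-- The norm `‖f‖_{H^σ} = ‖⟨D⟩ ^ σ f‖₂` with `⟨D⟩ = (1 - ∂ₓ²) ^ (1/2)`, whose symbol is
`(1 + k ^ 2) ^ (1/2)` at angular frequency `k = 2 π ξ`; by Plancherel it is computed on the
Fourier side. -/
noncomputable def sobolevNorm (σ : ℝ) (f : ℝ → ℂ) : ℝ≥0∞ :=
  eLpNorm (fun ξ : ℝ => (1 + (2 * Real.pi * ξ) ^ 2) ^ (σ / 2) • 𝓕 f ξ) 2 volume

/-- The weighted norm `‖|x| ^ s f‖₂`. -/
noncomputable def weightedNorm (s : ℝ) (f : ℝ → ℂ) : ℝ≥0∞ :=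
  eLpNorm (fun x : ℝ => |x| ^ s • f x) 2 volume

/-- `U(0)` is the identity on test functions. -/
theorem airyGroup_zero {f : ℝ → ℂ} (hf : ContDiff ℝ ∞ f) (hc : HasCompactSupport f) :
    airyGroup 0 f = f := by
  let g : SchwartzMap ℝ ℂ := hc.toSchwartzMap hf
  have hg : 𝓕 f = (𝓕 g : SchwartzMap ℝ ℂ) := SchwartzMap.fourier_coe g
  have h1 : airyGroup 0 f = 𝓕⁻ (𝓕 f) := by
    simp [airyGroup]
  rw [h1]
  exact hf.continuous.fourierInv_fourier_eq g.integrable (hg ▸ (𝓕 g).integrable)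

/-- `u(x, t) = (U(t) f)(x)` solves the linear equation `∂ₜ u + ∂ₓ³ u = 0`. -/
theorem hasDerivAt_airyGroup {f : ℝ → ℂ} (hf : ContDiff ℝ ∞ f) (hc : HasCompactSupport f)
    (t x : ℝ) :
    HasDerivAt (fun τ => airyGroup τ f x) (-iteratedDeriv 3 (airyGroup t f) x) t := by
  let g : SchwartzMap ℝ ℂ := hc.toSchwartzMap hf
  have hg : 𝓕 f = (𝓕 g : SchwartzMap ℝ ℂ) := SchwartzMap.fourier_coe g
  have hnorm (τ ξ : ℝ) : ‖Complex.exp (Complex.I * τ * (2 * Real.pi * ξ) ^ 3)‖ = 1 := by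
    have : Complex.I * τ * (2 * Real.pi * ξ) ^ 3
        = ((τ * (2 * Real.pi * ξ) ^ 3 : ℝ) : ℂ) * Complex.I := by push_cast; ring
    rw [this, Complex.norm_exp_ofReal_mul_I]
  have hint (τ : ℝ) (n : ℕ) : Integrable (fun ξ : ℝ =>
      ξ ^ n • (Complex.exp (Complex.I * τ * (2 * Real.pi * ξ) ^ 3) * 𝓕 f ξ)) := by
    refine ((𝓕 g).integrable_pow_mul volume n).mono' ?_ (.of_forall fun ξ => ?_)
    · rw [hg]
      exact (by fun_prop : Continuous _).aestronglyMeasurable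
    · rw [norm_smul, norm_mul, hnorm, hg]
      simp
  have hx : iteratedDeriv 3 (airyGroup t f) x = ∫ ξ : ℝ,
      Complex.exp (2 * Real.pi * Complex.I * x * ξ) * ((2 * Real.pi * Complex.I * ξ) ^ 3 *
        (Complex.exp (Complex.I * t * (2 * Real.pi * ξ) ^ 3) * 𝓕 f ξ)) := by
    have h1 : airyGroup t f = fun y => 𝓕 (fun ξ : ℝ =>
        Complex.exp (Complex.I * t * (2 * Real.pi * ξ) ^ 3) * 𝓕 f ξ) (-y) := by
      ext y
      exact Real.fourierInv_eq_fourier_neg _ _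
    rw [h1, iteratedDeriv_comp_neg, Real.iteratedDeriv_fourier (N := ⊤)
      (fun n _ => hint t n) le_top, Real.fourier_real_eq_integral_exp_smul, ← integral_smul]
    refine integral_congr_ae (.of_forall fun ξ => ?_)
    have h2 : Complex.exp (((-2 * Real.pi * ξ * -x : ℝ) : ℂ) * Complex.I)
        = Complex.exp (2 * Real.pi * Complex.I * x * ξ) := by
      congr 1; push_cast; ring
    simp only [h2, smul_eq_mul, Complex.real_smul]
    push_cast
    ring
  have ht (τ : ℝ) : airyGroup τ f x = ∫ ξ : ℝ, Complex.exp (2 * Real.pi * Complex.I * x * ξ) *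
      (Complex.exp (Complex.I * τ * (2 * Real.pi * ξ) ^ 3) * 𝓕 f ξ) := by
    simp only [airyGroup]
    rw [Real.fourierInv_eq']
    refine integral_congr_ae (.of_forall fun ξ => ?_)
    simp only [smul_eq_mul]
    congr 2
    simp
    ring
  have hnx (ξ : ℝ) : ‖Complex.exp (2 * Real.pi * Complex.I * x * ξ)‖ = 1 := by
    have : 2 * Real.pi * Complex.I * x * ξ
        = ((2 * Real.pi * x * ξ : ℝ) : ℂ) * Complex.I := by push_cast; ring
    rw [this, Complex.norm_exp_ofReal_mul_I]
  simp only [ht]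
  rw [hx, ← integral_neg]
  refine (hasDerivAt_integral_of_dominated_loc_of_deriv_le (μ := volume)
    (bound := fun ξ : ℝ => (2 * Real.pi) ^ 3 * (‖ξ‖ ^ 3 * ‖(𝓕 g) ξ‖)) (s := Set.univ)
    (F' := fun (τ : ℝ) (ξ : ℝ) => -(Complex.exp (2 * Real.pi * Complex.I * x * ξ) *
      ((2 * Real.pi * Complex.I * ξ) ^ 3 *
        (Complex.exp (Complex.I * τ * (2 * Real.pi * ξ) ^ 3) * 𝓕 f ξ))))
    Filter.univ_mem ?_ ?_ ?_ ?_ ?_ ?_).2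
  · rw [hg]
    exact .of_forall fun τ => (by fun_prop : Continuous _).aestronglyMeasurable
  · refine ((hint t 0).norm).mono' ?_ (.of_forall fun ξ => ?_)
    · rw [hg]
      exact (by fun_prop : Continuous _).aestronglyMeasurable
    · rw [norm_mul, hnx]
      simp
  · rw [hg]
    exact (by fun_prop : Continuous _).aestronglyMeasurable
  · refine .of_forall fun ξ τ _ => ?_
    rw [norm_neg, norm_mul, hnx, norm_mul, norm_mul, hnorm, hg]
    simp [mul_pow, abs_of_pos Real.pi_pos, mul_assoc]
  · exact ((𝓕 g).integrable_pow_mul volume 3).const_mul _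
  · refine .of_forall fun ξ τ _ => ?_
    have h3 : HasDerivAt (fun τ : ℝ => Complex.I * (τ : ℂ) * (2 * Real.pi * ξ) ^ 3)
        (Complex.I * (2 * Real.pi * ξ) ^ 3) τ := by
      have := ((Complex.ofRealCLM.hasDerivAt (x := τ)).const_mul Complex.I).mul_const
        ((2 * Real.pi * ξ : ℂ) ^ 3)
      simpa using this
    refine ((h3.cexp.mul_const (𝓕 f ξ)).const_mul
      (Complex.exp (2 * Real.pi * Complex.I * x * ξ))).congr_deriv ?_
    have h4 : Complex.I ^ 3 = -Complex.I := by rw [pow_succ, Complex.I_sq]; ring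
    simp only [mul_pow, h4]
    ring

/-!
Cut `f` into pieces whose frequencies lie within unit distance of `η`. If the symbol satisfies
`|∂ʲa| ≤ A Mʲ` for a scale `M ≥ 1` that is nearly constant over unit distances, then on such a piece
the multiplier `a(D)` moves mass by a distance of order `M(η)`: each commutator `[x, a(D)]` is again
a multiplier, with symbol a multiple of `∂a`, and so costs a factor `M(η)`. This bounds `a(D)` in
`L²` with weight `(M(η) + |x|) ^ N`, and real interpolation over the truncated weights
`min (M(η) + |x|) L ^ (2 * N)` gives every real power. Plancherel in `η` and Peetre's inequality
reassemble the pieces, so that `‖⟨x⟩ˢ a(D) f‖₂` is controlled by `‖⟨x⟩ˢ f‖₂ + ‖Mˢ 𝓕 f‖₂`.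

For the Airy symbol, Cauchy's estimates on discs of radius `1 / M` give these bounds uniformly in
`t` with `M(ξ) = (1 + |t|) (1 + |2πξ|²)`, and `‖Mˢ 𝓕 f‖₂` is `(1 + |t|)ˢ` times the Sobolev norm of
order `2 * s`.
-/

open Function SchwartzMap LineDeriv

section Plancherel

variable {V H : Type*} [NormedAddCommGroup V] [InnerProductSpace ℝ V] [FiniteDimensional ℝ V]
  [MeasurableSpace V] [BorelSpace V] [NormedAddCommGroup H] [InnerProductSpace ℂ H]
  [CompleteSpace H]

theorem lintegral_enorm_sq_fourier (f : SchwartzMap V H) :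
    ∫⁻ ξ, ‖𝓕 f ξ‖ₑ ^ 2 = ∫⁻ x, ‖f x‖ₑ ^ 2 := by
  have key (g : SchwartzMap V H) : ∫⁻ x, ‖g x‖ₑ ^ 2 = ENNReal.ofReal (∫ x, ‖g x‖ ^ 2) := by
    have hint : Integrable fun x => ‖g x‖ ^ 2 := (g.memLp 2).integrable_norm_pow two_ne_zero
    rw [ofReal_integral_eq_lintegral_ofReal hint (.of_forall fun x => by positivity)]
    simp [ENNReal.ofReal_pow, ofReal_norm]
  rw [key, integral_norm_sq_fourier, ← key]

theorem lintegral_enorm_sq_fourierInv (f : SchwartzMap V H) :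
    ∫⁻ x, ‖𝓕⁻ f x‖ₑ ^ 2 = ∫⁻ ξ, ‖f ξ‖ₑ ^ 2 := by
  rw [← lintegral_enorm_sq_fourier, FourierTransform.fourier_fourierInv_eq]

theorem lintegral_enorm_sq_fourierMultiplier {m : V → ℂ} (hm : m.HasTemperateGrowth)
    (f : SchwartzMap V H) :
    ∫⁻ x, ‖fourierMultiplierCLM H m f x‖ₑ ^ 2 = ∫⁻ ξ, ‖m ξ‖ₑ ^ 2 * ‖𝓕 f ξ‖ₑ ^ 2 := by
  rw [fourierMultiplierCLM_apply, lintegral_enorm_sq_fourierInv]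
  simp only [smulLeftCLM_apply_apply hm, enorm_smul, mul_pow]

theorem lintegral_enorm_sq_fourierMultiplier_le {m : V → ℂ} (hm : m.HasTemperateGrowth)
    {A : ℝ≥0} (hA : ∀ ξ, ‖m ξ‖ ≤ A) (f : SchwartzMap V H) :
    ∫⁻ x, ‖fourierMultiplierCLM H m f x‖ₑ ^ 2 ≤ A ^ 2 * ∫⁻ x, ‖f x‖ₑ ^ 2 := by
  rw [lintegral_enorm_sq_fourierMultiplier hm, ← lintegral_enorm_sq_fourier f,
    ← lintegral_const_mul' _ _ (by finiteness)]
  gcongr with ξ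
  exact enorm_le_coe.2 (hA ξ)

end Plancherel

theorem hasTemperateGrowth_deriv {F : Type*} [NormedAddCommGroup F] [NormedSpace ℝ F] {m : ℝ → F}
    (hm : m.HasTemperateGrowth) : (deriv m).HasTemperateGrowth := by
  refine ⟨hm.1.deriv', fun n => ?_⟩
  obtain ⟨k, C, h⟩ := hm.2 (n + 1)
  refine ⟨k, C, fun x => ?_⟩
  simpa only [norm_iteratedFDeriv_eq_norm_iteratedDeriv, iteratedDeriv_succ'] using h x

theorem lineDeriv_smulLeftCLM {m : ℝ → ℂ} (hm : m.HasTemperateGrowth) (g : SchwartzMap ℝ ℂ) :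
    ∂_{(1 : ℝ)} (smulLeftCLM ℂ m g) =
      smulLeftCLM ℂ (deriv m) g + smulLeftCLM ℂ m (∂_{(1 : ℝ)} g) := by
  ext x
  have hm' := hasTemperateGrowth_deriv hm
  simp only [lineDerivOp_apply_eq_fderiv, fderiv_apply_one_eq_deriv, smulLeftCLM_apply hm,
    smulLeftCLM_apply_apply hm', smulLeftCLM_apply_apply hm, add_apply]
  rw [deriv_fun_smul (hm.1.differentiable (by simp) x) g.differentiableAt, add_comm]

theorem smulLeftCLM_id_fourierMultiplierCLM {m : ℝ → ℂ} (hm : m.HasTemperateGrowth)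
    (w : SchwartzMap ℝ ℂ) :
    smulLeftCLM ℂ (fun x : ℝ => x) (fourierMultiplierCLM ℂ m w) =
      fourierMultiplierCLM ℂ m (smulLeftCLM ℂ (fun x : ℝ => x) w) -
        (2 * Real.pi * Complex.I)⁻¹ • fourierMultiplierCLM ℂ (deriv m) w := by
  have h := congrArg (fun g => 𝓕⁻ g) (lineDeriv_smulLeftCLM hm (𝓕 w))
  simp only [fourierInv_lineDerivOp_eq, lineDerivOp_fourier_eq] at h
  simp only [Real.inner_apply, mul_one, neg_smul, FourierTransform.fourier_neg,
    FourierTransform.fourier_smul, map_neg, map_smul, FourierTransform.fourierInv_add,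
    FourierTransform.fourierInv_neg, FourierTransform.fourierInv_smul,
    ← fourierMultiplierCLM_apply] at h
  refine smul_right_injective _ Complex.two_pi_I_ne_zero ?_
  simp only [smul_sub, smul_inv_smul₀ Complex.two_pi_I_ne_zero]
  linear_combination (norm := module) (-1 : ℂ) • h

theorem enorm_mul_fourierMultiplier_le {m : ℝ → ℂ} (hm : m.HasTemperateGrowth)
    (w : SchwartzMap ℝ ℂ) (x : ℝ) :
    ‖x‖ₑ * ‖fourierMultiplierCLM ℂ m w x‖ₑ ≤
      ‖fourierMultiplierCLM ℂ m (smulLeftCLM ℂ (fun y : ℝ => y) w) x‖ₑ +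
        ‖fourierMultiplierCLM ℂ (deriv m) w x‖ₑ := by
  have hc : ‖(2 * Real.pi * Complex.I)⁻¹‖ₑ ≤ 1 := by
    rw [← ofReal_norm, ENNReal.ofReal_le_one, norm_inv]
    refine inv_le_one_of_one_le₀ ?_
    simp only [norm_mul, Complex.norm_I, Complex.norm_real, Complex.norm_ofNat, Real.norm_eq_abs,
      abs_of_pos Real.pi_pos]
    linarith [Real.pi_gt_three]
  have h := DFunLike.congr_fun (smulLeftCLM_id_fourierMultiplierCLM hm w) x
  rw [smulLeftCLM_apply_apply .id', sub_apply, smul_apply] at h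
  calc ‖x‖ₑ * ‖fourierMultiplierCLM ℂ m w x‖ₑ = ‖x • fourierMultiplierCLM ℂ m w x‖ₑ :=
        (enorm_smul _ _).symm
    _ ≤ _ := by
        rw [h]
        refine (enorm_sub_le).trans ?_
        rw [enorm_smul]
        gcongr
        exact mul_le_of_le_one_left' hc

/-- The symbol estimates `|∂ʲ a| ≤ A Mʲ` for `j ≤ N`: at frequency `ξ` the multiplier `a(D)` moves
mass over distances of order `M ξ`. Temperate growth makes `a(D)` act on Schwartz functions. -/
structure HasSymbolBounds (N : ℕ) (A : ℝ≥0) (M : ℝ → ℝ≥0) (a : ℝ → ℂ) : Prop where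
  hasTemperateGrowth : a.HasTemperateGrowth
  norm_iteratedDeriv_le : ∀ j ≤ N, ∀ ξ, ‖iteratedDeriv j a ξ‖ ≤ A * M ξ ^ j

namespace HasSymbolBounds

variable {N : ℕ} {A : ℝ≥0} {M : ℝ → ℝ≥0} {a : ℝ → ℂ}

theorem norm_le (ha : HasSymbolBounds N A M a) (ξ : ℝ) : ‖a ξ‖ ≤ A := by
  simpa using ha.norm_iteratedDeriv_le 0 N.zero_le ξ

theorem of_succ (ha : HasSymbolBounds (N + 1) A M a) : HasSymbolBounds N A M a :=
  ⟨ha.1, fun j hj => ha.2 j (hj.trans N.le_succ)⟩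

theorem deriv_of_const {M : ℝ≥0} (ha : HasSymbolBounds (N + 1) A (fun _ => M) a) :
    HasSymbolBounds N (A * M) (fun _ => M) (deriv a) := by
  refine ⟨hasTemperateGrowth_deriv ha.1, fun j hj ξ => ?_⟩
  rw [← iteratedDeriv_succ']
  exact (ha.2 (j + 1) (by lia) ξ).trans_eq (by push_cast; ring)

end HasSymbolBounds

theorem add_sq_le_two_mul_add_sq (a b : ℝ≥0∞) : (a + b) ^ 2 ≤ 2 * (a ^ 2 + b ^ 2) := by
  have h := ENNReal.rpow_add_le_mul_rpow_add_rpow a b one_le_two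
  norm_num at h
  exact h

theorem sq_mul_enorm_sq_fourierMultiplier_le {m : ℝ → ℂ} (hm : m.HasTemperateGrowth) (M : ℝ≥0)
    (w : SchwartzMap ℝ ℂ) (x : ℝ) :
    (M + ‖x‖ₑ) ^ 2 * ‖fourierMultiplierCLM ℂ m w x‖ₑ ^ 2 ≤
      2 * M ^ 2 * ‖fourierMultiplierCLM ℂ m w x‖ₑ ^ 2 +
        (4 * ‖fourierMultiplierCLM ℂ m (smulLeftCLM ℂ (fun y : ℝ => y) w) x‖ₑ ^ 2 +
          4 * ‖fourierMultiplierCLM ℂ (deriv m) w x‖ₑ ^ 2) := by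
  set u := ‖fourierMultiplierCLM ℂ m w x‖ₑ
  set v := ‖fourierMultiplierCLM ℂ m (smulLeftCLM ℂ (fun y : ℝ => y) w) x‖ₑ
  set v' := ‖fourierMultiplierCLM ℂ (deriv m) w x‖ₑ
  calc (M + ‖x‖ₑ) ^ 2 * u ^ 2 = (M * u + ‖x‖ₑ * u) ^ 2 := by ring
    _ ≤ 2 * ((M * u) ^ 2 + (‖x‖ₑ * u) ^ 2) := add_sq_le_two_mul_add_sq _ _
    _ ≤ 2 * ((M * u) ^ 2 + (v + v') ^ 2) := by gcongr; exact enorm_mul_fourierMultiplier_le hm w x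
    _ ≤ 2 * ((M * u) ^ 2 + 2 * (v ^ 2 + v' ^ 2)) := by gcongr; exact add_sq_le_two_mul_add_sq _ _
    _ = 2 * M ^ 2 * u ^ 2 + (4 * v ^ 2 + 4 * v' ^ 2) := by ring

theorem lintegral_sq_mul_enorm_sq_fourierMultiplier_le {m : ℝ → ℂ} (hm : m.HasTemperateGrowth)
    (M : ℝ≥0) (w : SchwartzMap ℝ ℂ) {ρ : ℝ → ℝ≥0∞} (hρ : Measurable ρ) :
    ∫⁻ x, ρ x * (M + ‖x‖ₑ) ^ 2 * ‖fourierMultiplierCLM ℂ m w x‖ₑ ^ 2 ≤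
      2 * M ^ 2 * (∫⁻ x, ρ x * ‖fourierMultiplierCLM ℂ m w x‖ₑ ^ 2) +
        (4 * (∫⁻ x, ρ x *
            ‖fourierMultiplierCLM ℂ m (smulLeftCLM ℂ (fun y : ℝ => y) w) x‖ₑ ^ 2) +
          4 * ∫⁻ x, ρ x * ‖fourierMultiplierCLM ℂ (deriv m) w x‖ₑ ^ 2) := by
  have hmeas (g : SchwartzMap ℝ ℂ) : Measurable fun x => ρ x * ‖g x‖ₑ ^ 2 := by fun_prop
  rw [← lintegral_const_mul _ (hmeas _), ← lintegral_const_mul _ (hmeas _),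
    ← lintegral_const_mul _ (hmeas _), ← lintegral_add_left (by fun_prop),
    ← lintegral_add_left (by fun_prop)]
  refine lintegral_mono fun x => ?_
  rw [mul_assoc]
  exact (mul_le_mul_right (sq_mul_enorm_sq_fourierMultiplier_le hm M w x) _).trans_eq (by ring)

theorem lintegral_pow_mul_enorm_sq_fourierMultiplier_le {N : ℕ} {A M : ℝ≥0} {m : ℝ → ℂ}
    (hm : HasSymbolBounds N A (fun _ => M) m) (w : SchwartzMap ℝ ℂ) :
    ∫⁻ x, (M + ‖x‖ₑ) ^ (2 * N) * ‖fourierMultiplierCLM ℂ m w x‖ₑ ^ 2 ≤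
      10 ^ N * A ^ 2 * ∫⁻ x, (M + ‖x‖ₑ) ^ (2 * N) * ‖w x‖ₑ ^ 2 := by
  induction N generalizing A m w with
  | zero => simpa using lintegral_enorm_sq_fourierMultiplier_le hm.1 hm.norm_le w
  | succ N ih =>
    set xw : SchwartzMap ℝ ℂ := smulLeftCLM ℂ (fun x : ℝ => x) w with hxw
    have hmeas (g : SchwartzMap ℝ ℂ) :
        Measurable fun x => (M + ‖x‖ₑ) ^ (2 * N) * ‖g x‖ₑ ^ 2 := by fun_prop
    calc ∫⁻ x, (M + ‖x‖ₑ) ^ (2 * (N + 1)) * ‖fourierMultiplierCLM ℂ m w x‖ₑ ^ 2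
        = ∫⁻ x, (M + ‖x‖ₑ) ^ (2 * N) * (M + ‖x‖ₑ) ^ 2 *
            ‖fourierMultiplierCLM ℂ m w x‖ₑ ^ 2 := by simp only [mul_add, mul_one, pow_add]
      _ ≤ 2 * M ^ 2 * (∫⁻ x, (M + ‖x‖ₑ) ^ (2 * N) * ‖fourierMultiplierCLM ℂ m w x‖ₑ ^ 2) +
            (4 * (∫⁻ x, (M + ‖x‖ₑ) ^ (2 * N) * ‖fourierMultiplierCLM ℂ m xw x‖ₑ ^ 2) +
              4 * ∫⁻ x, (M + ‖x‖ₑ) ^ (2 * N) * ‖fourierMultiplierCLM ℂ (deriv m) w x‖ₑ ^ 2) :=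
          lintegral_sq_mul_enorm_sq_fourierMultiplier_le hm.1 M w (by fun_prop)
      _ ≤ 2 * M ^ 2 * (10 ^ N * A ^ 2 * ∫⁻ x, (M + ‖x‖ₑ) ^ (2 * N) * ‖w x‖ₑ ^ 2) +
            (4 * (10 ^ N * A ^ 2 * ∫⁻ x, (M + ‖x‖ₑ) ^ (2 * N) * ‖xw x‖ₑ ^ 2) +
              4 * (10 ^ N * (A * M : ℝ≥0) ^ 2 *
                ∫⁻ x, (M + ‖x‖ₑ) ^ (2 * N) * ‖w x‖ₑ ^ 2)) := by
          gcongr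
          exacts [ih hm.of_succ w, ih hm.of_succ xw, ih hm.deriv_of_const w]
      _ = 10 ^ N * A ^ 2 * ∫⁻ x, (6 * M ^ 2 * ((M + ‖x‖ₑ) ^ (2 * N) * ‖w x‖ₑ ^ 2) +
            4 * ((M + ‖x‖ₑ) ^ (2 * N) * ‖xw x‖ₑ ^ 2)) := by
          rw [lintegral_add_left (by fun_prop), lintegral_const_mul _ (hmeas _),
            lintegral_const_mul _ (hmeas _)]
          push_cast
          ring
      _ ≤ 10 ^ N * A ^ 2 * ∫⁻ x, 10 * ((M + ‖x‖ₑ) ^ (2 * (N + 1)) * ‖w x‖ₑ ^ 2) := by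
          gcongr with x
          rw [hxw, smulLeftCLM_apply_apply .id', enorm_smul]
          exact le_iff_exists_add.2 ⟨(M + ‖x‖ₑ) ^ (2 * N) * ‖w x‖ₑ ^ 2 *
            (4 * M ^ 2 + 20 * M * ‖x‖ₑ + 6 * ‖x‖ₑ ^ 2), by ring⟩
      _ = 10 ^ (N + 1) * A ^ 2 * ∫⁻ x, (M + ‖x‖ₑ) ^ (2 * (N + 1)) * ‖w x‖ₑ ^ 2 := by
          rw [lintegral_const_mul _ (by fun_prop)]
          ring

theorem lintegral_min_pow_fourierMultiplier_le_of_near {N : ℕ} {A M L : ℝ≥0} {m : ℝ → ℂ}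
    (hm : HasSymbolBounds N A (fun _ => M) m) {v : SchwartzMap ℝ ℂ}
    (hv : ∀ x, v x ≠ 0 → M + ‖x‖ₑ ≤ 3 * L) :
    ∫⁻ x, min (M + ‖x‖ₑ) L ^ (2 * N) * ‖fourierMultiplierCLM ℂ m v x‖ₑ ^ 2 ≤
      90 ^ N * A ^ 2 * ∫⁻ x, min (M + ‖x‖ₑ) L ^ (2 * N) * ‖v x‖ₑ ^ 2 := by
  have hpt (x : ℝ) : (M + ‖x‖ₑ) ^ (2 * N) * ‖v x‖ₑ ^ 2 ≤
      9 ^ N * (min (M + ‖x‖ₑ) L ^ (2 * N) * ‖v x‖ₑ ^ 2) := by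
    rcases eq_or_ne (v x) 0 with h | h
    · simp [h]
    · have h3 : M + ‖x‖ₑ ≤ 3 * min (M + ‖x‖ₑ) L := by
        rw [mul_min]
        exact le_min (le_mul_of_one_le_left' (by norm_num)) (hv x h)
      calc (M + ‖x‖ₑ) ^ (2 * N) * ‖v x‖ₑ ^ 2
          ≤ (3 * min (M + ‖x‖ₑ) L) ^ (2 * N) * ‖v x‖ₑ ^ 2 := by gcongr
        _ = 9 ^ N * (min (M + ‖x‖ₑ) L ^ (2 * N) * ‖v x‖ₑ ^ 2) := by
            rw [mul_pow, pow_mul 3, show (3 : ℝ≥0∞) ^ 2 = 9 by norm_num, mul_assoc]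
  calc ∫⁻ x, min (M + ‖x‖ₑ) L ^ (2 * N) * ‖fourierMultiplierCLM ℂ m v x‖ₑ ^ 2
      ≤ ∫⁻ x, (M + ‖x‖ₑ) ^ (2 * N) * ‖fourierMultiplierCLM ℂ m v x‖ₑ ^ 2 := by
        gcongr; exact min_le_left _ _
    _ ≤ 10 ^ N * A ^ 2 * ∫⁻ x, (M + ‖x‖ₑ) ^ (2 * N) * ‖v x‖ₑ ^ 2 :=
        lintegral_pow_mul_enorm_sq_fourierMultiplier_le hm v
    _ ≤ 10 ^ N * A ^ 2 * ∫⁻ x, 9 ^ N * (min (M + ‖x‖ₑ) L ^ (2 * N) * ‖v x‖ₑ ^ 2) := by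
        exact mul_le_mul_right (lintegral_mono hpt) _
    _ = 90 ^ N * A ^ 2 * ∫⁻ x, min (M + ‖x‖ₑ) L ^ (2 * N) * ‖v x‖ₑ ^ 2 := by
        rw [lintegral_const_mul' _ _ (by finiteness), show (90 : ℝ≥0∞) = 10 * 9 by norm_num,
          mul_pow]
        ring

theorem lintegral_min_pow_fourierMultiplier_le_of_far {A M L : ℝ≥0} {m : ℝ → ℂ}
    (hm : m.HasTemperateGrowth) (hA : ∀ ξ, ‖m ξ‖ ≤ A) (n : ℕ) {v : SchwartzMap ℝ ℂ}
    (hv : ∀ x, v x ≠ 0 → L ≤ M + ‖x‖ₑ) :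
    ∫⁻ x, min (M + ‖x‖ₑ) L ^ n * ‖fourierMultiplierCLM ℂ m v x‖ₑ ^ 2 ≤
      A ^ 2 * ∫⁻ x, min (M + ‖x‖ₑ) L ^ n * ‖v x‖ₑ ^ 2 := by
  calc ∫⁻ x, min (M + ‖x‖ₑ) L ^ n * ‖fourierMultiplierCLM ℂ m v x‖ₑ ^ 2
      ≤ ∫⁻ x, L ^ n * ‖fourierMultiplierCLM ℂ m v x‖ₑ ^ 2 := by
        gcongr; exact min_le_right _ _
    _ ≤ A ^ 2 * ∫⁻ x, L ^ n * ‖v x‖ₑ ^ 2 := by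
        rw [lintegral_const_mul' _ _ (by finiteness), lintegral_const_mul' _ _ (by finiteness),
          mul_left_comm]
        gcongr
        exact lintegral_enorm_sq_fourierMultiplier_le hm hA v
    _ = A ^ 2 * ∫⁻ x, min (M + ‖x‖ₑ) L ^ n * ‖v x‖ₑ ^ 2 := by
        congr 2 with x
        rcases eq_or_ne (v x) 0 with h | h
        · simp [h]
        · rw [min_eq_right (hv x h)]

theorem exists_eq_add_of_cutoff {V F : Type*} [NormedAddCommGroup V] [NormedSpace ℝ V]
    [FiniteDimensional ℝ V] [NormedAddCommGroup F] [NormedSpace ℝ F] (v : SchwartzMap V F) {L : ℝ}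
    (hL : 0 < L) :
    ∃ v₁ v₂ : SchwartzMap V F, v = v₁ + v₂ ∧ (∀ x, ‖v₁ x‖ₑ ≤ ‖v x‖ₑ) ∧ (∀ x, ‖v₂ x‖ₑ ≤ ‖v x‖ₑ) ∧
      (∀ x, v₁ x ≠ 0 → ‖x‖ ≤ 2 * L) ∧ ∀ x, v₂ x ≠ 0 → L ≤ ‖x‖ := by
  let χ : ContDiffBump (0 : V) := ⟨L, 2 * L, hL, by linarith⟩
  have hχ : Function.HasTemperateGrowth χ := χ.hasCompactSupport.hasTemperateGrowth χ.contDiff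
  have h₁ (x : V) : smulLeftCLM F χ v x = χ x • v x := smulLeftCLM_apply_apply hχ v x
  have h₂ (x : V) : (v - smulLeftCLM F χ v) x = (1 - χ x) • v x := by
    rw [sub_apply, h₁, sub_smul, one_smul]
  have hle {r : ℝ} (hr₀ : 0 ≤ r) (hr₁ : r ≤ 1) (y : F) : ‖r • y‖ₑ ≤ ‖y‖ₑ := by
    rw [enorm_le_iff_norm_le, norm_smul, Real.norm_of_nonneg hr₀]
    exact mul_le_of_le_one_left (norm_nonneg y) hr₁
  refine ⟨smulLeftCLM F χ v, v - smulLeftCLM F χ v, by simp, fun x => ?_, fun x => ?_,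
    fun x => ?_, fun x => ?_⟩
  · exact h₁ x ▸ hle χ.nonneg χ.le_one _
  · exact h₂ x ▸ hle (sub_nonneg.2 χ.le_one) (sub_le_self _ χ.nonneg) _
  · contrapose!
    intro hx
    rw [h₁, χ.zero_of_le_dist (by simpa using hx.le), zero_smul]
  · contrapose!
    intro hx
    rw [h₂, χ.one_of_mem_closedBall (by simpa using hx.le), sub_self, zero_smul]

theorem lintegral_min_pow_fourierMultiplier_le {N : ℕ} {A M L : ℝ≥0} {m : ℝ → ℂ}
    (hm : HasSymbolBounds N A (fun _ => M) m) (hL : 0 < L) (v : SchwartzMap ℝ ℂ) :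
    ∫⁻ x, min (M + ‖x‖ₑ) L ^ (2 * N) * ‖fourierMultiplierCLM ℂ m v x‖ₑ ^ 2 ≤
      2 * (90 ^ N + 1) * A ^ 2 * ∫⁻ x, min (M + ‖x‖ₑ) L ^ (2 * N) * ‖v x‖ₑ ^ 2 := by
  rcases le_total L M with hLM | hML
  · refine (lintegral_min_pow_fourierMultiplier_le_of_far hm.1 hm.norm_le _ fun x _ =>
      (ENNReal.coe_le_coe.2 hLM).trans le_self_add).trans ?_
    gcongr
    refine le_mul_of_one_le_left' ?_
    exact one_le_mul (by norm_num) le_add_self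
  obtain ⟨v₁, v₂, hv, hle₁, hle₂, hv₁, hv₂⟩ := exists_eq_add_of_cutoff v (L := L) hL
  set I := ∫⁻ x, min (M + ‖x‖ₑ) L ^ (2 * N) * ‖v x‖ₑ ^ 2
  have hnear : ∫⁻ x, min (M + ‖x‖ₑ) L ^ (2 * N) * ‖fourierMultiplierCLM ℂ m v₁ x‖ₑ ^ 2 ≤
      90 ^ N * A ^ 2 * I := by
    refine (lintegral_min_pow_fourierMultiplier_le_of_near hm fun x hx => ?_).trans ?_
    · have : ‖x‖ₑ ≤ (2 * L : ℝ≥0) := enorm_le_coe.2 (by exact_mod_cast hv₁ x hx)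
      calc M + ‖x‖ₑ ≤ L + (2 * L : ℝ≥0) := by gcongr
        _ = 3 * L := by push_cast; ring
    · gcongr
      exact lintegral_mono fun x => by gcongr; exact hle₁ x
  have hfar : ∫⁻ x, min (M + ‖x‖ₑ) L ^ (2 * N) * ‖fourierMultiplierCLM ℂ m v₂ x‖ₑ ^ 2 ≤
      A ^ 2 * I := by
    refine (lintegral_min_pow_fourierMultiplier_le_of_far hm.1 hm.norm_le _ fun x hx =>
      le_add_of_le_right ?_).trans ?_
    · exact coe_le_enorm.2 (by exact_mod_cast hv₂ x hx)
    · gcongr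
      exact lintegral_mono fun x => by gcongr; exact hle₂ x
  calc ∫⁻ x, min (M + ‖x‖ₑ) L ^ (2 * N) * ‖fourierMultiplierCLM ℂ m v x‖ₑ ^ 2
      ≤ ∫⁻ x, (2 * (min (M + ‖x‖ₑ) L ^ (2 * N) * ‖fourierMultiplierCLM ℂ m v₁ x‖ₑ ^ 2) +
        2 * (min (M + ‖x‖ₑ) L ^ (2 * N) * ‖fourierMultiplierCLM ℂ m v₂ x‖ₑ ^ 2)) := by
        refine lintegral_mono fun x => ?_
        rw [hv, map_add, add_apply, ← mul_add, ← mul_add, mul_left_comm]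
        gcongr
        exact (pow_le_pow_left' (enorm_add_le _ _) 2).trans (add_sq_le_two_mul_add_sq _ _)
    _ ≤ 2 * (90 ^ N * A ^ 2 * I) + 2 * (A ^ 2 * I) := by
        rw [lintegral_add_left (by fun_prop), lintegral_const_mul _ (by fun_prop),
          lintegral_const_mul _ (by fun_prop)]
        gcongr
    _ = 2 * (90 ^ N + 1) * A ^ 2 * I := by ring

theorem integrable_exp_mul_min_pow {p : ℝ} {q : ℕ} (hp : 0 < p) (hpq : p < q) :
    Integrable fun τ : ℝ => Real.exp ((p - q) * τ) * min 1 (Real.exp τ) ^ q := by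
  rw [← integrableOn_univ, ← Set.Iic_union_Ioi (a := (0 : ℝ))]
  refine IntegrableOn.union ?_ ?_
  · refine (integrableOn_exp_mul_Iic hp 0).congr_fun (fun τ hτ => ?_) measurableSet_Iic
    rw [min_eq_right (Real.exp_le_one_iff.2 hτ), ← Real.exp_nat_mul, ← Real.exp_add]
    ring_nf
  · refine (integrableOn_exp_mul_Ioi (sub_neg.2 hpq) 0).congr_fun (fun τ hτ => ?_)
      measurableSet_Ioi
    rw [min_eq_left (Real.one_le_exp (le_of_lt hτ)), one_pow, mul_one]

theorem exp_mul_min_exp_pow_eq (p : ℝ) (q : ℕ) (a τ : ℝ) :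
    ENNReal.ofReal (Real.exp ((p - q) * τ)) *
        min (ENNReal.ofReal (Real.exp a)) (ENNReal.ofReal (Real.exp τ)) ^ q =
      ENNReal.ofReal (Real.exp (p * a)) *
        ENNReal.ofReal (Real.exp ((p - q) * (τ - a)) * min 1 (Real.exp (τ - a)) ^ q) := by
  have hmin : min (Real.exp a) (Real.exp τ) = Real.exp a * min 1 (Real.exp (τ - a)) := by
    rw [mul_min_of_nonneg _ _ (Real.exp_pos a).le, mul_one, ← Real.exp_add, add_sub_cancel]
  have hexp : Real.exp ((p - q) * τ) * Real.exp a ^ q =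
      Real.exp (p * a) * Real.exp ((p - q) * (τ - a)) := by
    rw [← Real.exp_nat_mul, ← Real.exp_add, ← Real.exp_add]
    ring_nf
  rw [← ENNReal.ofReal_min, ← ENNReal.ofReal_pow (by positivity), ← ENNReal.ofReal_mul
    (by positivity), ← ENNReal.ofReal_mul (by positivity), hmin, mul_pow, ← mul_assoc, hexp,
    mul_assoc]

theorem exists_lintegral_exp_mul_min_pow_eq {p : ℝ} {q : ℕ} (hp : 0 < p) (hpq : p < q) :
    ∃ c : ℝ≥0, c ≠ 0 ∧ ∀ y : ℝ≥0, ∫⁻ τ : ℝ, ENNReal.ofReal (Real.exp ((p - q) * τ)) *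
      min (y : ℝ≥0∞) (ENNReal.ofReal (Real.exp τ)) ^ q = c * (y : ℝ≥0∞) ^ p := by
  have hint := integrable_exp_mul_min_pow hp hpq
  set k : ℝ → ℝ := fun τ => Real.exp ((p - q) * τ) * min 1 (Real.exp τ) ^ q
  have hk₀ (τ : ℝ) : 0 < k τ := by positivity
  refine ⟨(∫ τ, k τ).toNNReal, ?_, fun y => ?_⟩
  · rw [Ne, Real.toNNReal_eq_zero, not_le, integral_pos_iff_support_of_nonneg (fun τ => (hk₀ τ).le)
      hint, Function.support_eq_univ fun τ => (hk₀ τ).ne']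
    simp
  have hc : ((∫ τ, k τ).toNNReal : ℝ≥0∞) = ∫⁻ τ, ENNReal.ofReal (k τ) :=
    ofReal_integral_eq_lintegral_ofReal hint (.of_forall fun τ => (hk₀ τ).le)
  rcases eq_or_ne y 0 with rfl | hy
  · have hq : q ≠ 0 := by
      rintro rfl
      exact hp.not_gt (by simpa using hpq)
    simp [hp, hq]
  obtain ⟨a, rfl⟩ : ∃ a, y = (Real.exp a).toNNReal :=
    ⟨Real.log y, by rw [Real.exp_log (by positivity), Real.toNNReal_coe]⟩
  calc _ = ∫⁻ τ, ENNReal.ofReal (Real.exp (p * a)) * ENNReal.ofReal (k (τ - a)) :=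
        lintegral_congr fun τ => exp_mul_min_exp_pow_eq p q a τ
    _ = ENNReal.ofReal (Real.exp (p * a)) * ∫⁻ τ, ENNReal.ofReal (k τ) := by
        rw [lintegral_const_mul' _ _ (by finiteness),
          lintegral_sub_right_eq_self (fun τ => ENNReal.ofReal (k τ))]
    _ = _ := by
        rw [hc, mul_comm, mul_comm p, Real.exp_mul,
          ← ENNReal.ofReal_rpow_of_pos (Real.exp_pos a)]
        rfl

-- `y ^ p` is an average over `L` of the truncations `min y L ^ (2 * N)`, whose bounds are uniform
-- in `L`; this is what allows fractional powers of the weight.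
theorem lintegral_rpow_fourierMultiplier_le {p : ℝ} {N : ℕ} (hp : 0 ≤ p) (hN : p < 2 * N)
    {A M : ℝ≥0} {m : ℝ → ℂ} (hm : HasSymbolBounds N A (fun _ => M) m) (v : SchwartzMap ℝ ℂ) :
    ∫⁻ x, (M + ‖x‖ₑ) ^ p * ‖fourierMultiplierCLM ℂ m v x‖ₑ ^ 2 ≤
      2 * (90 ^ N + 1) * A ^ 2 * ∫⁻ x, (M + ‖x‖ₑ) ^ p * ‖v x‖ₑ ^ 2 := by
  set D : ℝ≥0∞ := 2 * (90 ^ N + 1) * A ^ 2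
  rcases hp.eq_or_lt with rfl | hp
  · simp only [ENNReal.rpow_zero, one_mul]
    refine (lintegral_enorm_sq_fourierMultiplier_le hm.1 hm.norm_le v).trans ?_
    gcongr
    exact le_mul_of_one_le_left' (one_le_mul (by norm_num) le_add_self)
  obtain ⟨c, hc, hmellin⟩ := exists_lintegral_exp_mul_min_pow_eq (q := 2 * N) hp (by simpa using hN)
  have hrep (g : SchwartzMap ℝ ℂ) : c * ∫⁻ x, (M + ‖x‖ₑ) ^ p * ‖g x‖ₑ ^ 2 =
      ∫⁻ τ : ℝ, ENNReal.ofReal (Real.exp ((p - (2 * N : ℕ)) * τ)) *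
        ∫⁻ x, min (M + ‖x‖ₑ) (Real.exp τ).toNNReal ^ (2 * N) * ‖g x‖ₑ ^ 2 := by
    calc _ = ∫⁻ x, ∫⁻ τ : ℝ, ENNReal.ofReal (Real.exp ((p - (2 * N : ℕ)) * τ)) *
            min (M + ‖x‖ₑ) (ENNReal.ofReal (Real.exp τ)) ^ (2 * N) * ‖g x‖ₑ ^ 2 := by
          rw [← lintegral_const_mul _ (by fun_prop)]
          refine lintegral_congr fun x => ?_
          have hx := hmellin (M + ‖x‖₊)
          rw [ENNReal.coe_add, ← enorm_eq_nnnorm] at hx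
          rw [lintegral_mul_const _ (by fun_prop), hx, mul_assoc]
      _ = _ := by
          rw [lintegral_lintegral_swap (by fun_prop)]
          refine lintegral_congr fun τ => ?_
          rw [← lintegral_const_mul' _ _ (by finiteness)]
          simp only [mul_assoc]
          rfl
  refine (ENNReal.mul_le_mul_iff_right (ENNReal.coe_ne_zero.2 hc) ENNReal.coe_ne_top).1 ?_
  rw [mul_left_comm, hrep, hrep, ← lintegral_const_mul' _ _ (by finiteness)]
  refine lintegral_mono fun τ => ?_
  rw [mul_left_comm]
  gcongr
  exact lintegral_min_pow_fourierMultiplier_le hm (by positivity) v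

section PeetreWeight

variable {V : Type*} [NormedAddCommGroup V]

theorem one_add_enorm_le_mul (x y : V) : 1 + ‖x‖ₑ ≤ (1 + ‖y‖ₑ) * (1 + ‖x + y‖ₑ) := by
  have h : ‖x‖ₑ ≤ ‖x + y‖ₑ + ‖y‖ₑ := by
    simpa only [add_sub_cancel_right] using enorm_sub_le (E := V) (a := x + y) (b := y)
  calc 1 + ‖x‖ₑ ≤ 1 + (‖x + y‖ₑ + ‖y‖ₑ) := by gcongr
    _ ≤ 1 + (‖x + y‖ₑ + ‖y‖ₑ) + ‖y‖ₑ * ‖x + y‖ₑ := le_self_add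
    _ = (1 + ‖y‖ₑ) * (1 + ‖x + y‖ₑ) := by ring

theorem one_add_enorm_add_le_mul (x y : V) : 1 + ‖x + y‖ₑ ≤ (1 + ‖y‖ₑ) * (1 + ‖x‖ₑ) := by
  simpa using one_add_enorm_le_mul (x + y) (-y)

variable {H : Type*} [NormedSpace ℝ V] [MeasurableSpace V] [BorelSpace V] [NormedAddCommGroup H]
  [NormedSpace ℝ H]

theorem lintegral_enorm_sq_mul_one_add_rpow_ne_zero {g : SchwartzMap V H} (hg : g ≠ 0) (p : ℝ)
    (μ : Measure V) [μ.IsOpenPosMeasure] :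
    ∫⁻ y, ‖g y‖ₑ ^ 2 * (1 + ‖y‖ₑ) ^ p ∂μ ≠ 0 := by
  rw [Ne, lintegral_eq_zero_iff (by fun_prop)]
  contrapose! hg
  have h0 : g =ᵐ[μ] 0 := by
    filter_upwards [hg] with y hy
    have : (1 + ‖y‖ₑ) ^ p ≠ 0 := by simp [ENNReal.rpow_eq_zero_iff]
    simpa [this] using hy
  exact DFunLike.coe_injective ((g.continuous.ae_eq_iff_eq μ continuous_zero).1 h0)

theorem lintegral_enorm_sq_mul_one_add_rpow_lt_top [FiniteDimensional ℝ V] (g : SchwartzMap V H)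
    (p : ℝ) (μ : Measure V) [μ.HasTemperateGrowth] :
    ∫⁻ y, ‖g y‖ₑ ^ 2 * (1 + ‖y‖ₑ) ^ p ∂μ < ⊤ := by
  obtain ⟨k, hk⟩ := exists_nat_ge p
  obtain ⟨C, hC⟩ : ∃ C : ℝ≥0, ∀ y, (1 + ‖y‖ₑ) ^ p * ‖g y‖ₑ ≤ C := by
    refine ⟨(2 ^ k * (Finset.Iic (k, 0)).sup (fun m => SchwartzMap.seminorm ℝ m.1 m.2) g).toNNReal,
      fun y => ?_⟩
    calc (1 + ‖y‖ₑ) ^ p * ‖g y‖ₑ ≤ (1 + ‖y‖ₑ) ^ (k : ℝ) * ‖g y‖ₑ := by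
          gcongr
          exact le_self_add
      _ = ENNReal.ofReal ((1 + ‖y‖) ^ k * ‖iteratedFDeriv ℝ 0 g y‖) := by
          rw [norm_iteratedFDeriv_zero, ENNReal.ofReal_mul (by positivity),
            ENNReal.ofReal_pow (by positivity), ENNReal.ofReal_add zero_le_one (norm_nonneg y),
            ENNReal.ofReal_one, ofReal_norm, ofReal_norm, ENNReal.rpow_natCast]
      _ ≤ _ := ENNReal.ofReal_le_ofReal
          (one_add_le_sup_seminorm_apply (m := (k, 0)) le_rfl le_rfl g y)
  calc ∫⁻ y, ‖g y‖ₑ ^ 2 * (1 + ‖y‖ₑ) ^ p ∂μ ≤ ∫⁻ y, C * ‖g y‖ₑ ∂μ := by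
        refine lintegral_mono fun y => ?_
        calc ‖g y‖ₑ ^ 2 * (1 + ‖y‖ₑ) ^ p = ((1 + ‖y‖ₑ) ^ p * ‖g y‖ₑ) * ‖g y‖ₑ := by ring
          _ ≤ C * ‖g y‖ₑ := by gcongr; exact hC y
    _ = C * ∫⁻ y, ‖g y‖ₑ ∂μ := lintegral_const_mul' _ _ (by finiteness)
    _ < ⊤ := ENNReal.mul_lt_top ENNReal.coe_lt_top g.integrable.2

end PeetreWeight

section FrequencyLocalization

variable {V H : Type*} [NormedAddCommGroup V] [InnerProductSpace ℝ V] [NormedAddCommGroup H]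
  [InnerProductSpace ℂ H]

theorem hasTemperateGrowth_window (φ : SchwartzMap V ℂ) (η : V) :
    (fun ξ => φ (η - ξ)).HasTemperateGrowth :=
  φ.hasTemperateGrowth.comp ((Function.HasTemperateGrowth.const η).sub .id')

variable [FiniteDimensional ℝ V] [MeasurableSpace V] [BorelSpace V]

/-- The part of `f` with frequencies near `η`, cut out by the window `φ`; as a function of `(η, x)`
it is a short-time Fourier transform of `f`. -/
noncomputable def freqPiece (φ : SchwartzMap V ℂ) (f : SchwartzMap V H) (η : V) : SchwartzMap V H :=
  fourierMultiplierCLM H (fun ξ => φ (η - ξ)) f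

theorem freqPiece_apply (φ : SchwartzMap V ℂ) (f : SchwartzMap V H) (η x : V) :
    freqPiece φ f η x = ∫ ξ, Real.fourierChar (inner ℝ ξ x) • φ (η - ξ) • 𝓕 f ξ := by
  rw [freqPiece, fourierMultiplierCLM_apply, fourierInv_coe, Real.fourierInv_eq]
  simp only [smulLeftCLM_apply_apply (hasTemperateGrowth_window φ η)]

theorem continuous_freqPiece (φ : SchwartzMap V ℂ) (f : SchwartzMap V H) :
    Continuous fun z : V × V => freqPiece φ f z.1 z.2 := by
  simp only [freqPiece_apply]
  obtain ⟨C, hC⟩ := φ.toBoundedContinuousFunction.bddAbove_range_norm_comp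
  refine continuous_of_dominated (bound := fun ξ => C * ‖𝓕 f ξ‖) (fun z => ?_)
    (fun z => .of_forall fun ξ => ?_) ((𝓕 f).integrable.norm.const_mul C)
    (.of_forall fun ξ => by fun_prop)
  · exact (by fun_prop : Continuous _).aestronglyMeasurable
  · rw [Circle.norm_smul, norm_smul]
    gcongr
    exact hC ⟨_, rfl⟩

theorem fourier_compSubConstCLM_neg (f : SchwartzMap V H) (x ξ : V) :
    𝓕 (compSubConstCLM ℂ (-x) f) ξ = Real.fourierChar (inner ℝ ξ x) • 𝓕 f ξ := by
  have h := congrFun (VectorFourier.fourierIntegral_comp_add_right Real.fourierChar volume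
    (innerₗ V) f x) ξ
  rw [innerₗ_apply_apply, real_inner_comm] at h
  rw [fourier_coe, fourier_coe]
  refine Eq.trans ?_ h
  refine congrFun (congrArg (𝓕 : (V → H) → V → H) (funext fun y => ?_)) ξ
  simp [compSubConstCLM_apply]

variable [CompleteSpace H]

theorem lintegral_enorm_sq_freqPiece (φ : SchwartzMap V ℂ) (f : SchwartzMap V H) (x : V) :
    ∫⁻ η, ‖freqPiece φ f η x‖ₑ ^ 2 = ∫⁻ y, ‖𝓕 φ y‖ₑ ^ 2 * ‖f (x - y)‖ₑ ^ 2 := by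
  set g : SchwartzMap V H := compSubConstCLM ℂ (-x) f
  have hconv (η : V) : freqPiece φ f η x =
      SchwartzMap.convolution (ContinuousLinearMap.lsmul ℂ ℂ) φ (𝓕 g) η := by
    rw [freqPiece_apply, convolution_apply, ← MeasureTheory.convolution_flip,
      MeasureTheory.convolution]
    refine integral_congr_ae (.of_forall fun ξ => ?_)
    simp only [g, fourier_compSubConstCLM_neg, ContinuousLinearMap.flip_apply,
      ContinuousLinearMap.lsmul_apply]
    exact smul_comm _ _ _
  have hg (y : V) : 𝓕 (𝓕 g) y = f (x - y) := by
    rw [← neg_neg y, fourier_coe, ← Real.fourierInv_eq_fourier_neg, ← fourierInv_coe,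
      FourierTransform.fourierInv_fourier_eq, compSubConstCLM_apply]
    congr 1
    abel
  simp only [hconv]
  rw [← lintegral_enorm_sq_fourier, fourier_convolution]
  simp only [pairing_apply_apply, hg, ContinuousLinearMap.lsmul_apply, enorm_smul, mul_pow]

theorem lintegral_lintegral_enorm_sq_freqPiece (φ : SchwartzMap V ℂ) (f : SchwartzMap V H)
    {W : V → ℝ≥0∞} (hW : Measurable W) :
    ∫⁻ η, ∫⁻ x, W x * ‖freqPiece φ f η x‖ₑ ^ 2 =
      ∫⁻ y, ‖𝓕 φ y‖ₑ ^ 2 * ∫⁻ x, W (x + y) * ‖f x‖ₑ ^ 2 := by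
  have hmeas : Measurable (uncurry fun η x => ‖freqPiece φ f η x‖ₑ ^ 2) :=
    (continuous_freqPiece φ f).enorm.measurable.pow_const 2
  have hmeas' : Measurable (uncurry fun x y => ‖f (x - y)‖ₑ ^ 2) :=
    (f.continuous.comp continuous_sub).enorm.measurable.pow_const 2
  have hφ : Measurable fun y => ‖𝓕 φ y‖ₑ ^ 2 := by fun_prop
  have hint (x : V) : Measurable fun y => ‖𝓕 φ y‖ₑ ^ 2 * ‖f (x - y)‖ₑ ^ 2 :=
    hφ.mul hmeas'.of_uncurry_left
  have hswap : Measurable (uncurry fun x y => W x * (‖𝓕 φ y‖ₑ ^ 2 * ‖f (x - y)‖ₑ ^ 2)) :=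
    (hW.comp measurable_fst).mul ((hφ.comp measurable_snd).mul hmeas')
  have hswap' : Measurable (uncurry fun η x => W x * ‖freqPiece φ f η x‖ₑ ^ 2) :=
    (hW.comp measurable_snd).mul hmeas
  calc ∫⁻ η, ∫⁻ x, W x * ‖freqPiece φ f η x‖ₑ ^ 2
      = ∫⁻ x, W x * ∫⁻ η, ‖freqPiece φ f η x‖ₑ ^ 2 := by
        rw [lintegral_lintegral_swap hswap'.aemeasurable]
        exact lintegral_congr fun x => lintegral_const_mul _ hmeas.of_uncurry_right
    _ = ∫⁻ x, ∫⁻ y, W x * (‖𝓕 φ y‖ₑ ^ 2 * ‖f (x - y)‖ₑ ^ 2) := by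
        refine lintegral_congr fun x => ?_
        rw [lintegral_enorm_sq_freqPiece, lintegral_const_mul _ (hint x)]
    _ = ∫⁻ y, ‖𝓕 φ y‖ₑ ^ 2 * ∫⁻ x, W x * ‖f (x - y)‖ₑ ^ 2 := by
        rw [lintegral_lintegral_swap hswap.aemeasurable]
        refine lintegral_congr fun y => ?_
        rw [← lintegral_const_mul' _ _ (by finiteness)]
        simp only [mul_left_comm]
    _ = ∫⁻ y, ‖𝓕 φ y‖ₑ ^ 2 * ∫⁻ x, W (x + y) * ‖f x‖ₑ ^ 2 := by
        refine lintegral_congr fun y => ?_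
        rw [← lintegral_add_right_eq_self _ y]
        simp only [add_sub_cancel_right]

theorem exists_lintegral_lintegral_freqPiece_le {p : ℝ} (hp : 0 ≤ p) (φ : SchwartzMap V ℂ) :
    ∃ C : ℝ≥0, ∀ f : SchwartzMap V H, ∫⁻ η, ∫⁻ x, (1 + ‖x‖ₑ) ^ p * ‖freqPiece φ f η x‖ₑ ^ 2 ≤
      C * ∫⁻ x, (1 + ‖x‖ₑ) ^ p * ‖f x‖ₑ ^ 2 := by
  lift ∫⁻ y, ‖𝓕 φ y‖ₑ ^ 2 * (1 + ‖y‖ₑ) ^ p to ℝ≥0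
    using (lintegral_enorm_sq_mul_one_add_rpow_lt_top (𝓕 φ) p volume).ne with C hC
  refine ⟨C, fun f => ?_⟩
  rw [lintegral_lintegral_enorm_sq_freqPiece φ f (by fun_prop), hC,
    ← lintegral_mul_const _ (by fun_prop)]
  refine lintegral_mono fun y => ?_
  rw [mul_assoc]
  refine mul_le_mul_right ?_ _
  rw [← lintegral_const_mul _ (by fun_prop)]
  refine lintegral_mono fun x => ?_
  rw [← mul_assoc, ← ENNReal.mul_rpow_of_nonneg _ _ hp]
  gcongr
  exact one_add_enorm_add_le_mul x y

theorem exists_lintegral_le_lintegral_lintegral_freqPiece {p : ℝ} (hp : 0 ≤ p)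
    {φ : SchwartzMap V ℂ} (hφ : φ ≠ 0) :
    ∃ C : ℝ≥0, ∀ f : SchwartzMap V H, ∫⁻ x, (1 + ‖x‖ₑ) ^ p * ‖f x‖ₑ ^ 2 ≤
      C * ∫⁻ η, ∫⁻ x, (1 + ‖x‖ₑ) ^ p * ‖freqPiece φ f η x‖ₑ ^ 2 := by
  have hφ' : 𝓕 φ ≠ 0 := fun h => hφ (by
    rw [← FourierTransform.fourierInv_fourier_eq (F := SchwartzMap V ℂ) φ, h]; simp)
  have hfin := (lintegral_enorm_sq_mul_one_add_rpow_lt_top (𝓕 φ) (-p) volume).ne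
  have hpos := lintegral_enorm_sq_mul_one_add_rpow_ne_zero hφ' (-p) volume
  lift ∫⁻ y, ‖𝓕 φ y‖ₑ ^ 2 * (1 + ‖y‖ₑ) ^ (-p) to ℝ≥0 using hfin with c hc
  refine ⟨c⁻¹, fun f => ?_⟩
  rw [ENNReal.coe_inv (by simpa using hpos), ← ENNReal.div_eq_inv_mul,
    ENNReal.le_div_iff_mul_le (.inl hpos) (.inl ENNReal.coe_ne_top), mul_comm,
    lintegral_lintegral_enorm_sq_freqPiece φ f (by fun_prop), hc,
    ← lintegral_mul_const _ (by fun_prop)]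
  refine lintegral_mono fun y => ?_
  rw [mul_assoc, ← lintegral_const_mul _ (by fun_prop)]
  refine mul_le_mul_right (lintegral_mono fun x => ?_) _
  rw [← mul_assoc, ENNReal.rpow_neg, ← ENNReal.div_eq_inv_mul]
  gcongr
  refine ENNReal.div_le_of_le_mul' ?_
  rw [← ENNReal.mul_rpow_of_nonneg _ _ hp]
  gcongr
  exact one_add_enorm_le_mul x y

end FrequencyLocalization

/-- A slowly varying scale: over a unit frequency window `M` may be treated as constant, at the cost
of a factor `K`. -/
structure IsSlowlyVarying (K : ℝ≥0) (M : ℝ → ℝ≥0) : Prop where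
  measurable : Measurable M
  one_le : ∀ ξ, 1 ≤ M ξ
  le_mul : ∀ ξ η, |η - ξ| ≤ 1 → M ξ ≤ K * M η

theorem exists_schwartzMap_ne_zero_tsupport_subset_closedBall :
    ∃ ψ : SchwartzMap ℝ ℂ, ψ ≠ 0 ∧ tsupport ψ ⊆ Metric.closedBall 0 1 := by
  let b : ContDiffBump (0 : ℝ) := ⟨1 / 2, 1, by norm_num, by norm_num⟩
  have hb : HasCompactSupport fun x => (b x : ℂ) :=
    b.hasCompactSupport.comp_left Complex.ofReal_zero
  refine ⟨hb.toSchwartzMap (Complex.ofRealCLM.contDiff.comp b.contDiff), fun h => ?_, ?_⟩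
  · have h0 : (b 0 : ℂ) = 0 := DFunLike.congr_fun h 0
    rw [b.one_of_mem_closedBall (by simp [b])] at h0
    simp at h0
  · exact (tsupport_comp_subset Complex.ofReal_zero b).trans b.tsupport_eq.le

theorem exists_forall_norm_iteratedDeriv_le {F : Type*} [NormedAddCommGroup F] [NormedSpace ℝ F]
    (N : ℕ) (ψ : SchwartzMap ℝ F) :
    ∃ B : ℝ≥0, ∀ j ≤ N, ∀ ξ, ‖iteratedDeriv j ψ ξ‖ ≤ B := by
  refine ⟨((Finset.Iic (0, N)).sup (fun m => SchwartzMap.seminorm ℝ m.1 m.2) ψ).toNNReal,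
    fun j hj ξ => le_trans ?_ (Real.le_coe_toNNReal _)⟩
  simpa [norm_iteratedFDeriv_eq_norm_iteratedDeriv] using
    one_add_le_sup_seminorm_apply (𝕜 := ℝ) (m := (0, N)) le_rfl hj ψ ξ

theorem iteratedDeriv_eq_zero_of_notMem_tsupport {F : Type*} [NormedAddCommGroup F]
    [NormedSpace ℝ F] {f : ℝ → F} {x : ℝ} (hx : x ∉ tsupport f) (j : ℕ) :
    iteratedDeriv j f x = 0 := by
  rw [← norm_eq_zero, ← norm_iteratedFDeriv_eq_norm_iteratedDeriv, norm_eq_zero]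
  exact notMem_support.1 fun h => hx (support_iteratedFDeriv_subset j h)

theorem HasSymbolBounds.norm_mul_iteratedDeriv_window_le {N : ℕ} {A B K : ℝ≥0} {M : ℝ → ℝ≥0}
    {a : ℝ → ℂ} (ha : HasSymbolBounds N A M a) (hM : IsSlowlyVarying K M) {ψ : SchwartzMap ℝ ℂ}
    (hψ : tsupport ψ ⊆ Metric.closedBall 0 1) (hB : ∀ j ≤ N, ∀ ξ, ‖iteratedDeriv j ψ ξ‖ ≤ B)
    {i j : ℕ} (hi : i ≤ N) (hj : j ≤ N) (ξ η : ℝ) :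
    ‖iteratedDeriv i a ξ * iteratedDeriv j (fun ξ => ψ (η - ξ)) ξ‖ ≤ A * B * (K * M η) ^ i := by
  rw [iteratedDeriv_comp_const_sub, norm_mul, norm_smul, norm_pow, norm_neg, norm_one, one_pow,
    one_mul]
  by_cases h : η - ξ ∈ tsupport ψ
  · have hle : M ξ ≤ K * M η := hM.le_mul ξ η (by simpa using hψ h)
    calc _ ≤ (A * M ξ ^ i : ℝ) * B :=
          mul_le_mul (ha.2 i hi ξ) (hB j hj _) (norm_nonneg _) (by positivity)
      _ ≤ A * (K * M η : ℝ≥0) ^ i * B := by gcongr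
      _ = _ := by push_cast; ring
  · rw [iteratedDeriv_eq_zero_of_notMem_tsupport h, norm_zero, mul_zero]
    positivity

theorem HasSymbolBounds.mul_window {N : ℕ} {A B K : ℝ≥0} {M : ℝ → ℝ≥0} {a : ℝ → ℂ}
    (ha : HasSymbolBounds N A M a) (hM : IsSlowlyVarying K M) {ψ : SchwartzMap ℝ ℂ}
    (hψ : tsupport ψ ⊆ Metric.closedBall 0 1) (hB : ∀ j ≤ N, ∀ ξ, ‖iteratedDeriv j ψ ξ‖ ≤ B)
    (η : ℝ) :
    HasSymbolBounds N (A * B * (1 + K) ^ N) (fun _ => M η) fun ξ => a ξ * ψ (η - ξ) := by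
  have hη := hasTemperateGrowth_window ψ η
  refine ⟨ha.1.mul hη, fun j hj ξ => ?_⟩
  rw [iteratedDeriv_fun_mul (ha.1.1.of_le (by exact_mod_cast le_top)).contDiffAt
    (hη.1.of_le (by exact_mod_cast le_top)).contDiffAt]
  calc _ ≤ ∑ i ∈ Finset.range (j + 1), (j.choose i : ℝ) * (A * B * (K * M η) ^ i) := by
        refine norm_sum_le_of_le _ fun i hi => ?_
        rw [mul_assoc, norm_mul, Complex.norm_natCast]
        gcongr
        have hij := Finset.mem_range_succ_iff.1 hi
        exact ha.norm_mul_iteratedDeriv_window_le hM hψ hB (hij.trans hj)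
          ((Nat.sub_le j i).trans hj) ξ η
    _ = A * B * (K * M η + 1) ^ j := by
        rw [add_pow, Finset.mul_sum]
        exact Finset.sum_congr rfl fun i _ => by ring
    _ ≤ A * B * ((1 + K) * M η) ^ j := by
        have h1 : (1 : ℝ) ≤ M η := hM.one_le η
        gcongr
        linarith
    _ ≤ A * B * ((1 + K) ^ N * M η ^ j) := by
        rw [mul_pow]
        gcongr
        exact le_add_of_nonneg_right K.2
    _ = _ := by push_cast; ring

-- The window is the square of `ψ`: one copy localises the symbol, the other localises `f`.
theorem freqPiece_smulLeftCLM_fourierMultiplierCLM {a : ℝ → ℂ} (ha : a.HasTemperateGrowth)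
    (ψ f : SchwartzMap ℝ ℂ) (η : ℝ) :
    freqPiece (smulLeftCLM ℂ ψ ψ) (fourierMultiplierCLM ℂ a f) η =
      fourierMultiplierCLM ℂ (fun ξ => a ξ * ψ (η - ξ)) (freqPiece ψ f η) := by
  have hη := hasTemperateGrowth_window ψ η
  rw [freqPiece, freqPiece, fourierMultiplierCLM_fourierMultiplierCLM_apply
    (hasTemperateGrowth_window _ η) ha, fourierMultiplierCLM_fourierMultiplierCLM_apply
    (g₁ := fun ξ => a ξ * ψ (η - ξ)) (ha.mul hη) hη]
  congr 2
  ext ξ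
  simp only [Pi.mul_apply, smulLeftCLM_apply_apply ψ.hasTemperateGrowth, smul_eq_mul]
  ring

theorem smulLeftCLM_self_ne_zero {ψ : SchwartzMap ℝ ℂ} (hψ : ψ ≠ 0) : smulLeftCLM ℂ ψ ψ ≠ 0 := by
  contrapose! hψ
  ext x
  simpa [smulLeftCLM_apply_apply ψ.hasTemperateGrowth] using DFunLike.congr_fun hψ x

theorem add_rpow_le_two_rpow_mul (a b : ℝ≥0∞) {p : ℝ} (hp : 0 ≤ p) :
    (a + b) ^ p ≤ 2 ^ p * (a ^ p + b ^ p) := by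
  wlog hab : a ≤ b generalizing a b
  · rw [add_comm a, add_comm (a ^ p)]
    exact this b a (le_of_not_ge hab)
  calc (a + b) ^ p ≤ (2 * b) ^ p := by rw [two_mul]; gcongr
    _ = 2 ^ p * b ^ p := ENNReal.mul_rpow_of_nonneg _ _ hp
    _ ≤ 2 ^ p * (a ^ p + b ^ p) := by gcongr; exact le_add_self

theorem IsSlowlyVarying.lintegral_rpow_mul_freqPiece_le {K : ℝ≥0} {M : ℝ → ℝ≥0}
    (hM : IsSlowlyVarying K M) {p : ℝ} (hp : 0 ≤ p) {ψ : SchwartzMap ℝ ℂ}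
    (hψ : tsupport ψ ⊆ Metric.closedBall 0 1) (f : SchwartzMap ℝ ℂ) :
    ∫⁻ η, (M η : ℝ≥0∞) ^ p * ∫⁻ x, ‖freqPiece ψ f η x‖ₑ ^ 2 ≤
      K ^ p * (∫⁻ ξ, ‖ψ ξ‖ₑ ^ 2) * ∫⁻ ξ, (M ξ : ℝ≥0∞) ^ p * ‖𝓕 f ξ‖ₑ ^ 2 := by
  have hMm := hM.measurable
  have hm : Measurable (uncurry fun η ξ => (M η : ℝ≥0∞) ^ p * ‖ψ (η - ξ)‖ₑ ^ 2) :=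
    ((hMm.comp measurable_fst).coe_nnreal_ennreal.pow_const p).mul
      ((ψ.continuous.comp continuous_sub).enorm.measurable.pow_const 2)
  have hf : Measurable fun ξ => ‖𝓕 f ξ‖ₑ ^ 2 := by fun_prop
  have hle (ξ η : ℝ) : (M η : ℝ≥0∞) ^ p * ‖ψ (η - ξ)‖ₑ ^ 2 ≤
      (K * M ξ : ℝ≥0∞) ^ p * ‖ψ (η - ξ)‖ₑ ^ 2 := by
    by_cases h : ψ (η - ξ) = 0
    · simp [h]
    · gcongr
      have hd : |ξ - η| ≤ 1 := by
        simpa [abs_sub_comm ξ] using hψ (subset_tsupport _ (mem_support.2 h))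
      exact_mod_cast hM.le_mul η ξ hd
  calc _ = ∫⁻ η, ∫⁻ ξ, (M η : ℝ≥0∞) ^ p * ‖ψ (η - ξ)‖ₑ ^ 2 * ‖𝓕 f ξ‖ₑ ^ 2 := by
        refine lintegral_congr fun η => ?_
        rw [freqPiece, lintegral_enorm_sq_fourierMultiplier (hasTemperateGrowth_window ψ η),
          ← lintegral_const_mul' _ _ (by finiteness)]
        simp only [mul_assoc]
    _ = ∫⁻ ξ, (∫⁻ η, (M η : ℝ≥0∞) ^ p * ‖ψ (η - ξ)‖ₑ ^ 2) * ‖𝓕 f ξ‖ₑ ^ 2 := by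
        rw [lintegral_lintegral_swap (hm.mul (hf.comp measurable_snd)).aemeasurable]
        exact lintegral_congr fun ξ => lintegral_mul_const _ hm.of_uncurry_right
    _ ≤ ∫⁻ ξ, (∫⁻ η, (K * M ξ : ℝ≥0∞) ^ p * ‖ψ (η - ξ)‖ₑ ^ 2) * ‖𝓕 f ξ‖ₑ ^ 2 := by
        exact lintegral_mono fun ξ => mul_le_mul_left (lintegral_mono (hle ξ)) _
    _ = ∫⁻ ξ, K ^ p * (∫⁻ ξ, ‖ψ ξ‖ₑ ^ 2) * ((M ξ : ℝ≥0∞) ^ p * ‖𝓕 f ξ‖ₑ ^ 2) := by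
        refine lintegral_congr fun ξ => ?_
        rw [lintegral_const_mul' _ _ (by finiteness), ENNReal.mul_rpow_of_nonneg _ _ hp,
          lintegral_sub_right_eq_self (fun η => ‖ψ η‖ₑ ^ 2)]
        ring
    _ = _ := lintegral_const_mul _ (by fun_prop)

theorem HasSymbolBounds.lintegral_rpow_freqPiece_le {N : ℕ} {A B K : ℝ≥0} {M : ℝ → ℝ≥0}
    {a : ℝ → ℂ} (ha : HasSymbolBounds N A M a) (hM : IsSlowlyVarying K M) {ψ : SchwartzMap ℝ ℂ}
    (hψ : tsupport ψ ⊆ Metric.closedBall 0 1) (hB : ∀ j ≤ N, ∀ ξ, ‖iteratedDeriv j ψ ξ‖ ≤ B)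
    {p : ℝ} (hp : 0 ≤ p) (hN : p < 2 * N) (f : SchwartzMap ℝ ℂ) (η : ℝ) :
    ∫⁻ x, (1 + ‖x‖ₑ) ^ p *
        ‖freqPiece (smulLeftCLM ℂ ψ ψ) (fourierMultiplierCLM ℂ a f) η x‖ₑ ^ 2 ≤
      2 * (90 ^ N + 1) * (A * B * (1 + K) ^ N : ℝ≥0) ^ 2 * 2 ^ p *
        ((∫⁻ x, (1 + ‖x‖ₑ) ^ p * ‖freqPiece ψ f η x‖ₑ ^ 2) +
          (M η : ℝ≥0∞) ^ p * ∫⁻ x, ‖freqPiece ψ f η x‖ₑ ^ 2) := by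
  rw [freqPiece_smulLeftCLM_fourierMultiplierCLM ha.1]
  set g := freqPiece ψ f η
  have h1 : (1 : ℝ≥0∞) ≤ M η := by exact_mod_cast hM.one_le η
  calc _ ≤ ∫⁻ x, (M η + ‖x‖ₑ) ^ p *
          ‖fourierMultiplierCLM ℂ (fun ξ => a ξ * ψ (η - ξ)) g x‖ₑ ^ 2 := by gcongr
    _ ≤ 2 * (90 ^ N + 1) * (A * B * (1 + K) ^ N : ℝ≥0) ^ 2 *
          ∫⁻ x, (M η + ‖x‖ₑ) ^ p * ‖g x‖ₑ ^ 2 :=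
        lintegral_rpow_fourierMultiplier_le hp hN (ha.mul_window hM hψ hB η) g
    _ ≤ 2 * (90 ^ N + 1) * (A * B * (1 + K) ^ N : ℝ≥0) ^ 2 *
          ∫⁻ x, 2 ^ p * ((1 + ‖x‖ₑ) ^ p * ‖g x‖ₑ ^ 2 + (M η : ℝ≥0∞) ^ p * ‖g x‖ₑ ^ 2) := by
        refine mul_le_mul_right (lintegral_mono fun x => ?_) _
        rw [← add_mul, ← mul_assoc]
        gcongr
        refine (add_rpow_le_two_rpow_mul _ _ hp).trans ?_
        rw [add_comm ((M η : ℝ≥0∞) ^ p)]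
        gcongr
        exact le_add_self
    _ = _ := by
        rw [lintegral_const_mul _ (by fun_prop), lintegral_add_left (by fun_prop),
          lintegral_const_mul _ (by fun_prop)]
        ring

theorem exists_lintegral_rpow_fourierMultiplier_le {p : ℝ} {N : ℕ} (hp : 0 ≤ p) (hN : p < 2 * N)
    (A K : ℝ≥0) :
    ∃ C : ℝ≥0, ∀ (a : ℝ → ℂ) (M : ℝ → ℝ≥0) (f : SchwartzMap ℝ ℂ),
      HasSymbolBounds N A M a → IsSlowlyVarying K M →
        ∫⁻ x, (1 + ‖x‖ₑ) ^ p * ‖fourierMultiplierCLM ℂ a f x‖ₑ ^ 2 ≤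
          C * ((∫⁻ x, (1 + ‖x‖ₑ) ^ p * ‖f x‖ₑ ^ 2) +
            ∫⁻ ξ, (M ξ : ℝ≥0∞) ^ p * ‖𝓕 f ξ‖ₑ ^ 2) := by
  obtain ⟨ψ, hψ0, hψ⟩ := exists_schwartzMap_ne_zero_tsupport_subset_closedBall
  obtain ⟨B, hB⟩ := exists_forall_norm_iteratedDeriv_le N ψ
  obtain ⟨C₁, hC₁⟩ := exists_lintegral_le_lintegral_lintegral_freqPiece (H := ℂ) hp
    (smulLeftCLM_self_ne_zero hψ0)
  obtain ⟨C₂, hC₂⟩ := exists_lintegral_lintegral_freqPiece_le (H := ℂ) hp ψ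
  lift ∫⁻ ξ, ‖ψ ξ‖ₑ ^ 2 to ℝ≥0 using by
    simpa using (lintegral_enorm_sq_mul_one_add_rpow_lt_top ψ 0 volume).ne with c hc
  set D : ℝ≥0 := 2 * (90 ^ N + 1) * (A * B * (1 + K) ^ N) ^ 2 * 2 ^ p with hD
  refine ⟨C₁ * D * (C₂ + K ^ p * c), fun a M f ha hM => ?_⟩
  have hmeas : Measurable fun η => ∫⁻ x, (1 + ‖x‖ₑ) ^ p * ‖freqPiece ψ f η x‖ₑ ^ 2 := by
    have := (continuous_freqPiece ψ f).measurable
    exact Measurable.lintegral_prod_right (by fun_prop)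
  set F := ∫⁻ x, (1 + ‖x‖ₑ) ^ p * ‖f x‖ₑ ^ 2
  set G := ∫⁻ ξ, (M ξ : ℝ≥0∞) ^ p * ‖𝓕 f ξ‖ₑ ^ 2
  have hlow := hM.lintegral_rpow_mul_freqPiece_le hp hψ f
  rw [← hc] at hlow
  calc _ ≤ C₁ * ∫⁻ η, ∫⁻ x, (1 + ‖x‖ₑ) ^ p *
          ‖freqPiece (smulLeftCLM ℂ ψ ψ) (fourierMultiplierCLM ℂ a f) η x‖ₑ ^ 2 := hC₁ _
    _ ≤ C₁ * ∫⁻ η, D * ((∫⁻ x, (1 + ‖x‖ₑ) ^ p * ‖freqPiece ψ f η x‖ₑ ^ 2) +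
          (M η : ℝ≥0∞) ^ p * ∫⁻ x, ‖freqPiece ψ f η x‖ₑ ^ 2) := by
        gcongr with η
        simpa [hD, ENNReal.coe_rpow_of_nonneg _ hp] using
          ha.lintegral_rpow_freqPiece_le hM hψ hB hp hN f η
    _ = C₁ * (D * ((∫⁻ η, ∫⁻ x, (1 + ‖x‖ₑ) ^ p * ‖freqPiece ψ f η x‖ₑ ^ 2) +
          ∫⁻ η, (M η : ℝ≥0∞) ^ p * ∫⁻ x, ‖freqPiece ψ f η x‖ₑ ^ 2)) := by
        rw [lintegral_const_mul' _ _ (by finiteness), lintegral_add_left hmeas]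
    _ ≤ C₁ * (D * (C₂ * F + K ^ p * c * G)) := by gcongr; exact hC₂ f
    _ ≤ C₁ * (D * ((C₂ + K ^ p * c) * (F + G))) := by
        refine mul_le_mul_right (mul_le_mul_right ?_ _) _
        exact le_iff_exists_add.2 ⟨C₂ * G + K ^ p * c * F, by ring⟩
    _ = _ := by
        rw [ENNReal.coe_mul (C₁ * D), ENNReal.coe_mul C₁, ENNReal.coe_add, ENNReal.coe_mul (K ^ p),
          ENNReal.coe_rpow_of_nonneg _ hp]
        ring

theorem contDiff_comp_ofReal {A : ℂ → ℂ} (hA : Differentiable ℂ A) :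
    ContDiff ℝ ∞ fun x : ℝ => A x :=
  (hA.contDiff.restrict_scalars ℝ).comp Complex.ofRealCLM.contDiff

theorem iteratedDeriv_comp_ofReal {A : ℂ → ℂ} (hA : Differentiable ℂ A) (j : ℕ) :
    iteratedDeriv j (fun x : ℝ => A x) = fun x : ℝ => iteratedDeriv j A x := by
  induction j with
  | zero => simp only [iteratedDeriv_zero]
  | succ j ih =>
    have hd : Differentiable ℂ (iteratedDeriv j A) :=
      (hA.contDiff (n := ∞)).differentiable_iteratedDeriv j
        (by exact_mod_cast ENat.natCast_lt_top j)
    ext x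
    rw [iteratedDeriv_succ, ih, iteratedDeriv_succ]
    exact ((hd x).hasDerivAt.comp_ofReal).deriv

theorem norm_iteratedDeriv_comp_ofReal_le {A : ℂ → ℂ} (hA : Differentiable ℂ A) {R C ξ : ℝ}
    (hR : 0 < R) (hC : ∀ z : ℂ, ‖z - ξ‖ ≤ R⁻¹ → ‖A z‖ ≤ C) (j : ℕ) :
    ‖iteratedDeriv j (fun x : ℝ => A x) ξ‖ ≤ j.factorial * C * R ^ j := by
  rw [iteratedDeriv_comp_ofReal hA]
  refine (Complex.norm_iteratedDeriv_le_of_forall_mem_sphere_norm_le j (inv_pos.2 hR)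
    hA.diffContOnCl fun z hz => hC z (mem_sphere_iff_norm.1 hz).le).trans_eq ?_
  rw [inv_pow, div_inv_eq_mul]

theorem hasSymbolBounds_of_differentiable {A : ℂ → ℂ} (hA : Differentiable ℂ A) {M : ℝ → ℝ≥0}
    (hM : ∀ ξ, 0 < M ξ) {C : ℝ≥0} (hC : ∀ (ξ : ℝ) (z : ℂ), ‖z - ξ‖ ≤ (M ξ : ℝ)⁻¹ → ‖A z‖ ≤ C)
    {D : ℝ} {k : ℕ} (hMD : ∀ ξ, M ξ ≤ D * (1 + ‖ξ‖) ^ k) (N : ℕ) :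
    HasSymbolBounds N (N.factorial * C) M fun ξ : ℝ => A ξ := by
  have hj (j : ℕ) (ξ : ℝ) := norm_iteratedDeriv_comp_ofReal_le hA (NNReal.coe_pos.2 (hM ξ)) (hC ξ) j
  refine ⟨⟨contDiff_comp_ofReal hA, fun j => ⟨k * j, j.factorial * C * D ^ j, fun ξ => ?_⟩⟩,
    fun j hjN ξ => (hj j ξ).trans ?_⟩
  · rw [norm_iteratedFDeriv_eq_norm_iteratedDeriv]
    refine (hj j ξ).trans ?_
    rw [pow_mul, mul_assoc _ (D ^ j), ← mul_pow]
    gcongr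
    exact hMD ξ
  · push_cast
    gcongr

/-- The entire extension of the symbol of the Airy group. -/
noncomputable def airySymbol (t : ℝ) (z : ℂ) : ℂ :=
  Complex.exp (Complex.I * t * (2 * Real.pi * z) ^ 3)

/-- The scale `(1 + |t|) (1 + |2πξ|²)` for the symbol estimates; up to a constant it dominates the
distance `3 |t| |2πξ|²` travelled in time `t` at frequency `ξ`. -/
noncomputable def airyWeight (t ξ : ℝ) : ℝ≥0 :=
  ⟨(1 + |t|) * (1 + (2 * Real.pi * ξ) ^ 2), by positivity⟩

theorem coe_airyWeight (t ξ : ℝ) :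
    (airyWeight t ξ : ℝ) = (1 + |t|) * (1 + (2 * Real.pi * ξ) ^ 2) := rfl

theorem one_le_airyWeight (t ξ : ℝ) : 1 ≤ airyWeight t ξ := by
  rw [← NNReal.coe_le_coe, coe_airyWeight]
  exact one_le_mul_of_one_le_of_one_le (by linarith [abs_nonneg t])
    (by linarith [sq_nonneg (2 * Real.pi * ξ)])

theorem isSlowlyVarying_airyWeight (t : ℝ) :
    IsSlowlyVarying (2 * (1 + (2 * NNReal.pi) ^ 2)) (airyWeight t) := by
  refine ⟨Continuous.measurable ?_, one_le_airyWeight t, fun ξ η h => ?_⟩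
  · unfold airyWeight
    fun_prop
  rw [← NNReal.coe_le_coe, NNReal.coe_mul, coe_airyWeight, coe_airyWeight, mul_left_comm]
  push_cast [NNReal.coe_real_pi]
  refine mul_le_mul_of_nonneg_left ?_ (by positivity)
  set c := 2 * Real.pi
  have hd : (c * (ξ - η)) ^ 2 ≤ c ^ 2 := by
    rw [mul_pow, ← sq_abs (ξ - η), abs_sub_comm]
    exact mul_le_of_le_one_right (sq_nonneg c) (pow_le_one₀ (abs_nonneg _) h)
  calc 1 + (c * ξ) ^ 2 ≤ 1 + 2 * ((c * η) ^ 2 + (c * (ξ - η)) ^ 2) := by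
        nlinarith [sq_nonneg (c * η - c * (ξ - η))]
    _ ≤ 2 * (1 + c ^ 2) * (1 + (c * η) ^ 2) := by
        nlinarith [mul_nonneg (sq_nonneg c) (sq_nonneg (c * η))]

theorem norm_exp_I_mul_add_cube_le (t k : ℝ) (w : ℂ) :
    ‖Complex.exp (Complex.I * t * (k + w) ^ 3)‖ ≤
      Real.exp (|t| * (‖w‖ * (3 * |k| ^ 2 + 3 * |k| * ‖w‖ + ‖w‖ ^ 2))) := by
  have hsplit : Complex.I * t * (k + w) ^ 3 = (t * k ^ 3 : ℝ) * Complex.I +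
      Complex.I * (t * (w * (3 * k ^ 2 + 3 * k * w + w ^ 2))) := by push_cast; ring
  rw [hsplit, Complex.exp_add, norm_mul, Complex.norm_exp_ofReal_mul_I, one_mul, Complex.norm_exp]
  refine Real.exp_le_exp.2 ((Complex.re_le_norm _).trans ?_)
  rw [norm_mul, norm_mul, norm_mul, Complex.norm_I, one_mul, Complex.norm_real, Real.norm_eq_abs]
  gcongr
  exact norm_add₃_le.trans_eq (by simp)

-- On this disc the phase differs from its real value at `ξ` by `O(|t| (1 + |2πξ|²) / M)`, which is
-- bounded uniformly in `t`.
theorem norm_airySymbol_le {t ξ : ℝ} {z : ℂ} (hz : ‖z - ξ‖ ≤ (airyWeight t ξ : ℝ)⁻¹) :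
    ‖airySymbol t z‖ ≤ Real.exp (40 * Real.pi ^ 3) := by
  have hpi := Real.pi_gt_three
  set k : ℝ := 2 * Real.pi * ξ with hk
  set w : ℂ := 2 * Real.pi * (z - ξ) with hw
  have hphase : (2 * Real.pi * z : ℂ) = k + w := by rw [hk, hw]; push_cast; ring
  have hwM : ‖w‖ * ((1 + |t|) * (1 + |k| ^ 2)) ≤ 2 * Real.pi := by
    have hM : (0 : ℝ) < airyWeight t ξ := zero_lt_one.trans_le (one_le_airyWeight t ξ)
    rw [hw, norm_mul, norm_mul, Complex.norm_real, Complex.norm_ofNat,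
      Real.norm_of_nonneg Real.pi_pos.le, mul_assoc, sq_abs]
    exact mul_le_of_le_one_right (by positivity) ((le_inv_mul_iff₀' hM).1 (by simpa using hz))
  have hw1 : ‖w‖ ≤ 2 * Real.pi := by
    refine le_trans (le_mul_of_one_le_right (norm_nonneg w) ?_) hwM
    rw [sq_abs]
    exact one_le_airyWeight t ξ
  have hq : 3 * |k| ^ 2 + 3 * |k| * ‖w‖ + ‖w‖ ^ 2 ≤ 20 * Real.pi ^ 2 * (1 + |k| ^ 2) := by
    nlinarith [sq_nonneg (|k| - ‖w‖), pow_le_pow_left₀ (norm_nonneg w) hw1 2,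
      mul_nonneg (sq_nonneg |k|) (by nlinarith : 0 ≤ 4 * Real.pi ^ 2 - 1)]
  rw [airySymbol, hphase]
  refine (norm_exp_I_mul_add_cube_le t k w).trans (Real.exp_le_exp.2 ?_)
  calc |t| * (‖w‖ * (3 * |k| ^ 2 + 3 * |k| * ‖w‖ + ‖w‖ ^ 2))
      ≤ (1 + |t|) * (‖w‖ * (20 * Real.pi ^ 2 * (1 + |k| ^ 2))) := by
        gcongr
        linarith
    _ = ‖w‖ * ((1 + |t|) * (1 + |k| ^ 2)) * (20 * Real.pi ^ 2) := by ring
    _ ≤ 2 * Real.pi * (20 * Real.pi ^ 2) := by gcongr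
    _ = 40 * Real.pi ^ 3 := by ring

theorem exists_hasSymbolBounds_airySymbol (N : ℕ) :
    ∃ A : ℝ≥0, ∀ t : ℝ, HasSymbolBounds N A (airyWeight t) fun ξ : ℝ => airySymbol t ξ := by
  refine ⟨N.factorial * (Real.exp (40 * Real.pi ^ 3)).toNNReal, fun t =>
    hasSymbolBounds_of_differentiable (by unfold airySymbol; fun_prop)
      (fun ξ => zero_lt_one.trans_le (one_le_airyWeight t ξ))
      (fun ξ z hz => (norm_airySymbol_le hz).trans (Real.le_coe_toNNReal _))
      (D := (1 + |t|) * (1 + (2 * Real.pi) ^ 2)) (k := 2) (fun ξ => ?_) N⟩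
  rw [coe_airyWeight, mul_assoc (1 + |t|), Real.norm_eq_abs, mul_pow, ← sq_abs ξ]
  gcongr
  nlinarith [abs_nonneg ξ, mul_nonneg (sq_nonneg (2 * Real.pi)) (abs_nonneg ξ)]

theorem airyGroup_coe (t : ℝ) (f : SchwartzMap ℝ ℂ) :
    airyGroup t f = fourierMultiplierCLM ℂ (fun ξ : ℝ => airySymbol t ξ) f := by
  obtain ⟨A, hA⟩ := exists_hasSymbolBounds_airySymbol 0
  rw [fourierMultiplierCLM_apply, fourierInv_coe, airyGroup, ← fourier_coe]
  congr 1
  ext ξ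
  rw [smulLeftCLM_apply_apply (hA t).1, smul_eq_mul, airySymbol]

theorem eLpNorm_two_sq {α E : Type*} [MeasurableSpace α] [NormedAddCommGroup E] (f : α → E)
    (μ : Measure α) : eLpNorm f 2 μ ^ 2 = ∫⁻ x, ‖f x‖ₑ ^ 2 ∂μ := by
  simpa using eLpNorm_nnreal_pow_eq_lintegral (p := 2) (f := f) (μ := μ) two_ne_zero

theorem weightedNorm_sq {s : ℝ} (hs : 0 ≤ s) (f : ℝ → ℂ) :
    weightedNorm s f ^ 2 = ∫⁻ x, ‖x‖ₑ ^ (2 * s) * ‖f x‖ₑ ^ 2 := by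
  rw [weightedNorm, eLpNorm_two_sq]
  refine lintegral_congr fun x => ?_
  rw [enorm_smul, mul_pow, Real.enorm_rpow_of_nonneg (abs_nonneg x) hs, Real.enorm_abs, mul_comm 2,
    ENNReal.rpow_mul, ENNReal.rpow_ofNat]

theorem lintegral_airyWeight_rpow {s : ℝ} (hs : 0 ≤ s) (t : ℝ) (f : ℝ → ℂ) :
    ∫⁻ ξ, (airyWeight t ξ : ℝ≥0∞) ^ (2 * s) * ‖𝓕 f ξ‖ₑ ^ 2 =
      ((1 + ‖t‖ₑ) ^ s * sobolevNorm (2 * s) f) ^ 2 := by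
  have hweight (ξ : ℝ) : (airyWeight t ξ : ℝ≥0∞) = (1 + ‖t‖ₑ) * ‖1 + (2 * Real.pi * ξ) ^ 2‖ₑ := by
    rw [← ENNReal.ofReal_coe_nnreal, coe_airyWeight, ENNReal.ofReal_mul (by positivity),
      ENNReal.ofReal_add zero_le_one (abs_nonneg t), ENNReal.ofReal_one,
      ← Real.enorm_eq_ofReal_abs, Real.enorm_of_nonneg
        (by positivity : 0 ≤ 1 + (2 * Real.pi * ξ) ^ 2)]
  rw [mul_pow, sobolevNorm, eLpNorm_two_sq, ← lintegral_const_mul' _ _ (by finiteness)]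
  refine lintegral_congr fun ξ => ?_
  rw [hweight, ENNReal.mul_rpow_of_nonneg _ _ (by positivity), enorm_smul, mul_pow ‖_‖ₑ,
    mul_div_cancel_left₀ s two_ne_zero, Real.enorm_rpow_of_nonneg (by positivity) hs, mul_comm 2,
    ENNReal.rpow_mul, ENNReal.rpow_mul, ENNReal.rpow_ofNat, ENNReal.rpow_ofNat, mul_assoc]

theorem lintegral_one_add_rpow_le {s : ℝ} (hs : 0 ≤ s) (t : ℝ) (f : SchwartzMap ℝ ℂ) :
    ∫⁻ x, (1 + ‖x‖ₑ) ^ (2 * s) * ‖f x‖ₑ ^ 2 ≤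
      2 ^ (2 * s) * (((1 + ‖t‖ₑ) ^ s * sobolevNorm (2 * s) f) ^ 2 + weightedNorm s f ^ 2) := by
  have hweight (ξ : ℝ) : 1 ≤ (airyWeight t ξ : ℝ≥0∞) ^ (2 * s) :=
    (ENNReal.one_rpow _).ge.trans
      (ENNReal.rpow_le_rpow (by exact_mod_cast one_le_airyWeight t ξ) (by positivity))
  calc _ ≤ ∫⁻ x, 2 ^ (2 * s) * (‖f x‖ₑ ^ 2 + ‖x‖ₑ ^ (2 * s) * ‖f x‖ₑ ^ 2) := by
        refine lintegral_mono fun x => ?_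
        rw [← one_add_mul, ← mul_assoc]
        gcongr
        simpa using add_rpow_le_two_rpow_mul 1 ‖x‖ₑ (p := 2 * s) (by positivity)
    _ = 2 ^ (2 * s) * ((∫⁻ ξ, ‖𝓕 f ξ‖ₑ ^ 2) + weightedNorm s f ^ 2) := by
        rw [lintegral_const_mul _ (by fun_prop), lintegral_add_left (by fun_prop),
          lintegral_enorm_sq_fourier, weightedNorm_sq hs]
    _ ≤ _ := by
        rw [← lintegral_airyWeight_rpow hs]
        gcongr with ξ
        exact le_mul_of_one_le_left' (hweight ξ)

theorem exists_weightedNorm_airyGroup_sq_le {s : ℝ} (hs : 0 ≤ s) :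
    ∃ C : ℝ≥0, ∀ (f : SchwartzMap ℝ ℂ) (t : ℝ), weightedNorm s (airyGroup t f) ^ 2 ≤
      C * (((1 + ‖t‖ₑ) ^ s * sobolevNorm (2 * s) f) ^ 2 + weightedNorm s f ^ 2) := by
  obtain ⟨N, hN⟩ := exists_nat_gt s
  obtain ⟨A, hA⟩ := exists_hasSymbolBounds_airySymbol N
  obtain ⟨C, hC⟩ := exists_lintegral_rpow_fourierMultiplier_le (p := 2 * s) (by positivity)
    (by gcongr) A (2 * (1 + (2 * NNReal.pi) ^ 2))
  refine ⟨C * (2 ^ (2 * s) + 1), fun f t => ?_⟩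
  set S := ((1 + ‖t‖ₑ) ^ s * sobolevNorm (2 * s) f) ^ 2 with hS
  set W := weightedNorm s f ^ 2
  calc weightedNorm s (airyGroup t f) ^ 2
      ≤ ∫⁻ x, (1 + ‖x‖ₑ) ^ (2 * s) *
          ‖fourierMultiplierCLM ℂ (fun ξ : ℝ => airySymbol t ξ) f x‖ₑ ^ 2 := by
        rw [weightedNorm_sq hs, airyGroup_coe]
        gcongr
        exact le_add_self
    _ ≤ C * ((∫⁻ x, (1 + ‖x‖ₑ) ^ (2 * s) * ‖f x‖ₑ ^ 2) + S) := by
        rw [hS, ← lintegral_airyWeight_rpow hs]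
        exact hC _ _ f (hA t) (isSlowlyVarying_airyWeight t)
    _ ≤ C * (2 ^ (2 * s) * (S + W) + (S + W)) := by
        gcongr
        exacts [lintegral_one_add_rpow_le hs t f, le_self_add]
    _ = _ := by
        push_cast [ENNReal.coe_rpow_of_nonneg _ (by positivity : 0 ≤ 2 * s)]
        ring

theorem le_sqrt_mul_add_of_sq_le {C : ℝ≥0} {a b c : ℝ≥0∞} (h : a ^ 2 ≤ C * (b ^ 2 + c ^ 2)) :
    a ≤ NNReal.sqrt C * (b + c) := by
  refine (ENNReal.pow_le_pow_left_iff two_ne_zero).1 (h.trans ?_)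
  rw [mul_pow, ← ENNReal.coe_pow, NNReal.sq_sqrt, add_sq]
  gcongr
  exact le_self_add

theorem lemma4p6_general (s : ℝ) (hs : 0 ≤ s) :
    ∃ C : ℝ≥0, ∀ (u₀ : SchwartzMap ℝ ℂ) (t : ℝ),
      weightedNorm s (airyGroup t u₀) ≤
        (C : ℝ≥0∞) * (ENNReal.ofReal (1 + |t| ^ s) * sobolevNorm (2 * s) u₀ +
          weightedNorm s u₀) := by
  obtain ⟨C, hC⟩ := exists_weightedNorm_airyGroup_sq_le hs
  refine ⟨NNReal.sqrt C * 2 ^ s, fun u₀ t => ?_⟩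
  have htime : (1 + ‖t‖ₑ) ^ s ≤ 2 ^ s * ENNReal.ofReal (1 + |t| ^ s) := by
    rw [ENNReal.ofReal_add zero_le_one (by positivity), ENNReal.ofReal_one,
      ← ENNReal.ofReal_rpow_of_nonneg (abs_nonneg t) hs, ← Real.enorm_eq_ofReal_abs]
    simpa using add_rpow_le_two_rpow_mul 1 ‖t‖ₑ hs
  have htwo : (1 : ℝ≥0∞) ≤ 2 ^ s :=
    (ENNReal.one_rpow s).ge.trans (ENNReal.rpow_le_rpow one_le_two hs)
  calc weightedNorm s (airyGroup t u₀)
      ≤ NNReal.sqrt C * ((1 + ‖t‖ₑ) ^ s * sobolevNorm (2 * s) u₀ + weightedNorm s u₀) :=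
        le_sqrt_mul_add_of_sq_le (hC u₀ t)
    _ ≤ NNReal.sqrt C * (2 ^ s * ENNReal.ofReal (1 + |t| ^ s) * sobolevNorm (2 * s) u₀ +
          2 ^ s * weightedNorm s u₀) := by
        gcongr
        exact le_mul_of_one_le_left' htwo
    _ = _ := by
        push_cast [ENNReal.coe_rpow_of_nonneg _ hs]
        ring

theorem lemma4p6 (s : ℝ) (hs : 0 ≤ s) :
    ∃ C : ℝ≥0, ∀ u₀ : ℝ → ℂ, ContDiff ℝ ∞ u₀ → HasCompactSupport u₀ → ∀ t : ℝ,
      weightedNorm s (airyGroup t u₀) ≤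
        (C : ℝ≥0∞) * (ENNReal.ofReal (1 + |t| + |t| ^ s) * sobolevNorm (2 * s) u₀ +
          weightedNorm s u₀) := by
  obtain ⟨C, hC⟩ := lemma4p6_general s hs
  refine ⟨C, fun u₀ hu hc t => (hC (hc.toSchwartzMap hu) t).trans ?_⟩
  gcongr _ * (ENNReal.ofReal (?_ + |t| ^ s) * sobolevNorm _ _ + _)
  exact le_add_of_nonneg_right (abs_nonneg t)
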